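/- Let $M$ be a $G_2$-manifold, i.e. a smooth $7$-manifold with a smooth $3$-form $\varphi$ such that - at every point $x$ there is a linear isomorphism $T_xM\cong\mathbb{R}^7$ carrying $\varphi_x$ to $$\varphi_0=e^{123}+e^{145}+e^{246}+e^{347}-e^{167}+e^{257}-e^{356}$$ (so that $\varphi$ determines a Riemannian metric $g_\varphi$, an orientation and a Hodge star $*_\varphi$, namely those that correspond under such isomorphisms to the Euclidean metric of $\mathbb{R}^7$ and the volume form $e^{1234567}$), and - $\varphi$ is parallel for the Levi-Civita connection of $g_\varphi$. Put $$\Lambda^3_{(3)}(M)=\{\beta\in\Lambda^3(M):\varphi\wedge\beta=0,\ *_\varphi\varphi\wedge\beta=0\},\qquad \Lambda^4_{(3)}(M)=\{\eta\in\Lambda^4(M):\varphi\wedge\eta=0,\ \varphi\wedge *_\varphi\eta=0\}.$$ Let $B$ be a smooth real $1$-form on $M$, regarded as a connection on the trivial $U(1)$-bundle, with curvature $F_B=dB$. Assume that $B$ is a special higher-order $U(1)$-instanton, i.e. $B\wedge dB\in\Lambda^3_{(3)}(M)$. Then 1. $B$ is an anti-self-dual higher-order $U(1)$-instanton, i.e.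 $dB\wedge dB\in\Lambda^4_{(3)}(M)$; 2. $B$ is closed ($dB=0$) if and only if $B\wedge *_\varphi dB=0$. -/

import Mathlib

open scoped Manifold ContDiff

noncomputable section

namespace GTwo

/-- The model space `ℝ⁷` with its standard Euclidean structure. -/
abbrev E7 : Type := EuclideanSpace ℝ (Fin 7)

/-- The standard orthonormal basis vectors `e₁, …, e₇` of `ℝ⁷` (indexed by `0, …, 6`). -/
def stdVec (i : Fin 7) : E7 := EuclideanSpace.single i (1 : ℝ)

section Algebra

/-! ### Multilinear algebra -/

variable {V : Type*} [AddCommGroup V] [Module ℝ V] [TopologicalSpace V]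

/-- The tensor product `α ⊗ β` of two alternating forms, as a multilinear form:
`(v₁, …, v_{k+l}) ↦ α (v₁, …, v_k) * β (v_{k+1}, …, v_{k+l})`. -/
def tensorForm {k l : ℕ} (α : V [⋀^Fin k]→L[ℝ] ℝ) (β : V [⋀^Fin l]→L[ℝ] ℝ) :
    ContinuousMultilinearMap ℝ (fun _ : Fin (k + l) => V) ℝ where
  toFun v := α (fun i => v (Fin.castAdd l i)) * β (fun j => v (Fin.natAdd k j))
  map_update_add' {inst} v i x y := by
    obtain rfl : inst = instDecidableEqFin (k + l) := Subsingleton.elim _ _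
    refine Fin.addCases (fun a => ?_) (fun b => ?_) i
    · have h1 : ∀ z : V, (fun i => Function.update v (Fin.castAdd l a) z (Fin.castAdd l i))
          = Function.update (fun i => v (Fin.castAdd l i)) a z := by
        intro z; ext i; by_cases h : i = a
        · subst h; simp
        · have h' : Fin.castAdd l i ≠ Fin.castAdd l a :=
            fun e => h (Fin.castAdd_injective _ _ e)
          simp [Function.update_of_ne h, Function.update_of_ne h']
      have h2 : ∀ z : V, (fun j => Function.update v (Fin.castAdd l a) z (Fin.natAdd k j))
          = (fun j => v (Fin.natAdd k j)) := by
        intro z; ext j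
        have h' : Fin.natAdd k j ≠ Fin.castAdd l a := by
          intro e; have := congrArg Fin.val e; have := a.2; simp at *; omega
        simp [Function.update_of_ne h']
      rw [h1, h1, h1, h2, h2, h2, α.map_update_add]; ring
    · have h1 : ∀ z : V, (fun i => Function.update v (Fin.natAdd k b) z (Fin.natAdd k i))
          = Function.update (fun i => v (Fin.natAdd k i)) b z := by
        intro z; ext i; by_cases h : i = b
        · subst h; simp
        · have h' : Fin.natAdd k i ≠ Fin.natAdd k b :=
            fun e => h (Fin.natAdd_injective _ _ e)
          simp [Function.update_of_ne h, Function.update_of_ne h']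
      have h2 : ∀ z : V, (fun j => Function.update v (Fin.natAdd k b) z (Fin.castAdd l j))
          = (fun j => v (Fin.castAdd l j)) := by
        intro z; ext j
        have h' : Fin.castAdd l j ≠ Fin.natAdd k b := by
          intro e; have := congrArg Fin.val e; have := j.2; simp at *; omega
        simp [Function.update_of_ne h']
      rw [h1, h1, h1, h2, h2, h2, β.map_update_add]; ring
  map_update_smul' {inst} v i c x := by
    obtain rfl : inst = instDecidableEqFin (k + l) := Subsingleton.elim _ _
    refine Fin.addCases (fun a => ?_) (fun b => ?_) i
    · have h1 : ∀ z : V, (fun i => Function.update v (Fin.castAdd l a) z (Fin.castAdd l i))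
          = Function.update (fun i => v (Fin.castAdd l i)) a z := by
        intro z; ext i; by_cases h : i = a
        · subst h; simp
        · have h' : Fin.castAdd l i ≠ Fin.castAdd l a :=
            fun e => h (Fin.castAdd_injective _ _ e)
          simp [Function.update_of_ne h, Function.update_of_ne h']
      have h2 : ∀ z : V, (fun j => Function.update v (Fin.castAdd l a) z (Fin.natAdd k j))
          = (fun j => v (Fin.natAdd k j)) := by
        intro z; ext j
        have h' : Fin.natAdd k j ≠ Fin.castAdd l a := by
          intro e; have := congrArg Fin.val e; have := a.2; simp at *; omega
        simp [Function.update_of_ne h']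
      rw [h1, h1, h2, h2, α.map_update_smul]; simp [mul_assoc]
    · have h1 : ∀ z : V, (fun i => Function.update v (Fin.natAdd k b) z (Fin.natAdd k i))
          = Function.update (fun i => v (Fin.natAdd k i)) b z := by
        intro z; ext i; by_cases h : i = b
        · subst h; simp
        · have h' : Fin.natAdd k i ≠ Fin.natAdd k b :=
            fun e => h (Fin.natAdd_injective _ _ e)
          simp [Function.update_of_ne h, Function.update_of_ne h']
      have h2 : ∀ z : V, (fun j => Function.update v (Fin.natAdd k b) z (Fin.castAdd l j))
          = (fun j => v (Fin.castAdd l j)) := by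
        intro z; ext j
        have h' : Fin.castAdd l j ≠ Fin.natAdd k b := by
          intro e; have := congrArg Fin.val e; have := j.2; simp at *; omega
        simp [Function.update_of_ne h']
      rw [h1, h1, h2, h2, β.map_update_smul]; simp; ring
  cont := by
    refine Continuous.mul (α.cont.comp ?_) (β.cont.comp ?_) <;> fun_prop

/-- The wedge product
`(α ∧ β)(v₁, …, v_{k+l}) = 1 / (k! l!) ∑_σ sgn σ α(v_{σ 1}, …, v_{σ k}) β(v_{σ (k+1)}, …)`. -/
def wedge {k l : ℕ} (α : V [⋀^Fin k]→L[ℝ] ℝ) (β : V [⋀^Fin l]→L[ℝ] ℝ) :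
    V [⋀^Fin (k + l)]→L[ℝ] ℝ :=
  ((k.factorial : ℝ) * (l.factorial : ℝ))⁻¹ • ContinuousMultilinearMap.alternatization (tensorForm α β)

end Algebra

/-- The form `e^{f(1) f(2) … f(k)} = e^{f(1)} ∧ ⋯ ∧ e^{f(k)}` on `ℝ⁷`, where `e^1, …, e^7` is
the dual basis: `(v₁, …, v_k) ↦ ∑_σ sgn σ ∏_a e^{f(a)}(v_{σ(a)})`. -/
def stdForm {k : ℕ} (f : Fin k → Fin 7) : E7 [⋀^Fin k]→L[ℝ] ℝ :=
  ContinuousMultilinearMap.alternatization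
    ((ContinuousMultilinearMap.mkPiAlgebra ℝ (Fin k) ℝ).compContinuousLinearMap
      (fun a => (EuclideanSpace.proj (f a) : E7 →L[ℝ] ℝ)))

/-- The standard `G₂`-form
`φ₀ = e^{123} + e^{145} + e^{246} + e^{347} - e^{167} + e^{257} - e^{356}` on `ℝ⁷`
(the indices `1, …, 7` are written `0, …, 6`). -/
def phi0 : E7 [⋀^Fin 3]→L[ℝ] ℝ :=
  stdForm ![0, 1, 2] + stdForm ![0, 3, 4] + stdForm ![1, 3, 5] + stdForm ![2, 3, 6]
    - stdForm ![0, 5, 6] + stdForm ![1, 4, 6] - stdForm ![2, 4, 5]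

/-- The standard volume form `e^{1234567}` on `ℝ⁷`. -/
def vol0 : E7 [⋀^Fin 7]→L[ℝ] ℝ := stdForm id

/-- The interior product `(v₁, …, v_l) ↦ η (w₁, …, w_k, v₁, …, v_l)`. -/
def interior {k l n : ℕ} (h : k + l = n) (η : E7 [⋀^Fin n]→L[ℝ] ℝ) (w : Fin k → E7) :
    E7 [⋀^Fin l]→L[ℝ] ℝ where
  toFun v := η (fun i => Fin.append w v (Fin.cast h.symm i))
  map_update_add' {inst} v i x y := by
    subst h
    obtain rfl : inst = instDecidableEqFin l := Subsingleton.elim _ _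
    have hu : ∀ z, Fin.append w (Function.update v i z)
        = Function.update (Fin.append w v) (Fin.natAdd k i) z := by
      intro z; funext j
      refine Fin.addCases (fun a => ?_) (fun b => ?_) j
      · have h' : Fin.castAdd l a ≠ Fin.natAdd k i := by
          intro e; have := congrArg Fin.val e; have := a.2; simp at *; omega
        simp [Function.update_of_ne h']
      · by_cases hb : b = i
        · subst hb; simp
        · have h' : Fin.natAdd k b ≠ Fin.natAdd k i :=
            fun e => hb (Fin.natAdd_injective _ _ e)
          simp [Function.update_of_ne hb, Function.update_of_ne h']
    simp only [Fin.cast_eq_self, hu, η.map_update_add]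
  map_update_smul' {inst} v i c x := by
    subst h
    obtain rfl : inst = instDecidableEqFin l := Subsingleton.elim _ _
    have hu : ∀ z, Fin.append w (Function.update v i z)
        = Function.update (Fin.append w v) (Fin.natAdd k i) z := by
      intro z; funext j
      refine Fin.addCases (fun a => ?_) (fun b => ?_) j
      · have h' : Fin.castAdd l a ≠ Fin.natAdd k i := by
          intro e; have := congrArg Fin.val e; have := a.2; simp at *; omega
        simp [Function.update_of_ne h']
      · by_cases hb : b = i
        · subst hb; simp
        · have h' : Fin.natAdd k b ≠ Fin.natAdd k i :=
            fun e => hb (Fin.natAdd_injective _ _ e)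
          simp [Function.update_of_ne hb, Function.update_of_ne h']
    simp only [Fin.cast_eq_self, hu, η.map_update_smul]
  cont := by
    subst h
    refine η.cont.comp (continuous_pi fun j => ?_)
    refine Fin.addCases (fun a => ?_) (fun b => ?_) j
    · simpa using continuous_const
    · simpa using continuous_apply b
  map_eq_zero_of_eq' v i j hv hij := by
    subst h
    refine η.map_eq_zero_of_eq (Fin.append w v) (i := Fin.natAdd k i) (j := Fin.natAdd k j) ?_ ?_
    · simpa using hv
    · exact fun e => hij (Fin.natAdd_injective _ _ e)

/-- The Hodge star of Euclidean `ℝ⁷` with volume form `e^{1234567}`, from `k`-forms to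
`l`-forms, `k + l = 7`:
`(*β)(v₁, …, v_l) = 1 / k! ∑_{f(1), …, f(k)} β(e_{f(1)}, …, e_{f(k)})
  vol(e_{f(1)}, …, e_{f(k)}, v₁, …, v_l)`. -/
def star0 {k l : ℕ} (h : k + l = 7) (β : E7 [⋀^Fin k]→L[ℝ] ℝ) : E7 [⋀^Fin l]→L[ℝ] ℝ :=
  (k.factorial : ℝ)⁻¹ • ∑ f : Fin k → Fin 7,
    β (fun a => stdVec (f a)) •
      interior h vol0 (fun a => stdVec (f a))

/-! ### Differential forms on a 7-manifold -/

section Manifold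

variable {M : Type*} [TopologicalSpace M] [ChartedSpace E7 M]

variable (M) in
/-- (Not necessarily smooth) differential `k`-forms on `M`. -/
abbrev DiffForm (k : ℕ) : Type _ := ∀ x : M, TangentSpace (𝓡 7) x [⋀^Fin k]→L[ℝ] ℝ

/-- The expression of a `k`-form in the preferred chart around `x₀`, i.e. its pullback by the
inverse of that chart; it is meaningful on the target of the chart. -/
def DiffForm.inChart {k : ℕ} (η : DiffForm M k) (x₀ : M) (y : E7) : E7 [⋀^Fin k]→L[ℝ] ℝ :=
  (η ((extChartAt (𝓡 7) x₀).symm y)).compContinuousLinearMap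
    (mfderiv 𝓘(ℝ, E7) (𝓡 7) (extChartAt (𝓡 7) x₀).symm y)

/-- A differential form is smooth if it is `C^∞` in the charts. -/
def DiffForm.IsSmooth {k : ℕ} (η : DiffForm M k) : Prop :=
  ∀ x₀ : M, ContDiffOn ℝ ∞ (η.inChart x₀) (extChartAt (𝓡 7) x₀).target

/-- The exterior derivative of a `k`-form: at `x`, it is computed in the preferred chart at `x`
and pulled back to `M`. -/
def DiffForm.d {k : ℕ} (η : DiffForm M k) : DiffForm M (k + 1) := fun x =>
  (extDeriv (η.inChart x) (extChartAt (𝓡 7) x x)).compContinuousLinearMap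
    (mfderiv (𝓡 7) 𝓘(ℝ, E7) (extChartAt (𝓡 7) x) x)

/-- The pointwise wedge product of differential forms. -/
def DiffForm.wedge {k l : ℕ} (α : DiffForm M k) (β : DiffForm M l) : DiffForm M (k + l) :=
  fun x => GTwo.wedge (α x) (β x)

/-- A form is closed if its exterior derivative vanishes. -/
def DiffForm.IsClosed {k : ℕ} (η : DiffForm M k) : Prop := η.d = 0

/-! ### `G₂`-structures -/

variable (M) in
/-- A `G₂`-structure on a 7-manifold: a smooth 3-form `φ` which at each point is identified with
`φ₀` by some linear isomorphism `T_x M ≅ ℝ⁷`. -/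
structure GTwoStructure where
  /-- The fundamental 3-form. -/
  φ : DiffForm M 3
  smooth : φ.IsSmooth
  exists_frame : ∀ x : M, ∃ L : TangentSpace (𝓡 7) x ≃L[ℝ] E7,
    φ x = phi0.compContinuousLinearMap (L : TangentSpace (𝓡 7) x →L[ℝ] E7)

namespace GTwoStructure

/-- An isomorphism `T_x M ≅ ℝ⁷` that identifies `φ` with `φ₀`. It is unique up to the stabilizer
of `φ₀` in `GL(7, ℝ)`, which is the group `G₂ ⊆ SO(7)`; so the metric and the Hodge star defined
below do not depend on the choice. -/
def frame (G : GTwoStructure M) (x : M) : TangentSpace (𝓡 7) x ≃L[ℝ] E7 :=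
  Classical.choose (G.exists_frame x)

/-- The chosen isomorphism does identify `φ` with `φ₀`. -/
theorem phi_eq (G : GTwoStructure M) (x : M) :
    G.φ x = phi0.compContinuousLinearMap (G.frame x : TangentSpace (𝓡 7) x →L[ℝ] E7) :=
  Classical.choose_spec (G.exists_frame x)

/-- The Riemannian metric `g_φ` determined by `φ`: the one that corresponds to the Euclidean
metric of `ℝ⁷` when `φ` corresponds to `φ₀`. -/
def metric (G : GTwoStructure M) (x : M) (u v : TangentSpace (𝓡 7) x) : ℝ :=
  inner ℝ (G.frame x u) (G.frame x v)

/-- The Hodge star `*_φ` of the metric and the orientation determined by `φ`. -/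
def star (G : GTwoStructure M) {k l : ℕ} (h : k + l = 7) (β : DiffForm M k) : DiffForm M l :=
  fun x =>
    (star0 h ((β x).compContinuousLinearMap
      ((G.frame x).symm : E7 →L[ℝ] TangentSpace (𝓡 7) x))).compContinuousLinearMap
      (G.frame x : TangentSpace (𝓡 7) x →L[ℝ] E7)

/-- The matrix `g_{ij}` of the metric `g_φ` in the preferred chart around `x₀`. -/
def metricInChart (G : GTwoStructure M) (x₀ : M) (y : E7) : Matrix (Fin 7) (Fin 7) ℝ :=
  fun i j => G.metric ((extChartAt (𝓡 7) x₀).symm y)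
    (mfderiv 𝓘(ℝ, E7) (𝓡 7) (extChartAt (𝓡 7) x₀).symm y (stdVec i))
    (mfderiv 𝓘(ℝ, E7) (𝓡 7) (extChartAt (𝓡 7) x₀).symm y (stdVec j))

/-- The Christoffel symbols `Γ^m_{ij} = 1/2 ∑_l g^{ml} (∂_i g_{jl} + ∂_j g_{il} - ∂_l g_{ij})` of
the Levi-Civita connection of `g_φ` in the preferred chart around `x₀`. -/
def christoffel (G : GTwoStructure M) (x₀ : M) (y : E7) (m i j : Fin 7) : ℝ :=
  (1 / 2 : ℝ) * ∑ l : Fin 7, (G.metricInChart x₀ y)⁻¹ m l *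
    (fderiv ℝ (fun z => G.metricInChart x₀ z j l) y (stdVec i)
      + fderiv ℝ (fun z => G.metricInChart x₀ z i l) y (stdVec j)
      - fderiv ℝ (fun z => G.metricInChart x₀ z i j) y (stdVec l))

/-- The components `(∇_i η)_{f(1) … f(k)} = ∂_i η_{f(1) … f(k)} - ∑_{s, m} Γ^m_{i f(s)}
η_{f(1) … m … f(k)}` (with `m` in position `s`) of the covariant derivative of a `k`-form for the
Levi-Civita connection of `g_φ`, in the preferred chart around `x₀`. -/
def covDeriv (G : GTwoStructure M) {k : ℕ} (η : DiffForm M k) (x₀ : M) (y : E7)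
    (i : Fin 7) (f : Fin k → Fin 7) : ℝ :=
  fderiv ℝ (fun z => η.inChart x₀ z (fun a => stdVec (f a))) y (stdVec i)
    - ∑ s : Fin k, ∑ m : Fin 7, G.christoffel x₀ y m i (f s) *
        η.inChart x₀ y (fun a => stdVec (Function.update f s m a))

/-- The `G₂`-structure is torsion-free: `φ` is parallel for the Levi-Civita connection of `g_φ`.
A `G₂`-manifold is a 7-manifold with a torsion-free `G₂`-structure. -/
def IsTorsionFree (G : GTwoStructure M) : Prop :=
  ∀ x₀ : M, ∀ y ∈ (extChartAt (𝓡 7) x₀).target, ∀ (i : Fin 7) (f : Fin 3 → Fin 7),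
    G.covDeriv G.φ x₀ y i f = 0

/-- The fundamental 4-form `*_φ φ`. -/
def psi (G : GTwoStructure M) : DiffForm M 4 := G.star (k := 3) (l := 4) rfl G.φ

/-- `Λ³₍₃₎`: the 3-forms `β` with `φ ∧ β = 0` and `*_φ φ ∧ β = 0`. -/
def Lambda33 (G : GTwoStructure M) : Set (DiffForm M 3) :=
  {β | G.φ.wedge β = 0 ∧ G.psi.wedge β = 0}

/-- `Λ⁴₍₃₎`: the 4-forms `η` with `φ ∧ η = 0` and `φ ∧ *_φ η = 0`. -/
def Lambda43 (G : GTwoStructure M) : Set (DiffForm M 4) :=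
  {η | G.φ.wedge η = 0 ∧ G.φ.wedge (G.star (k := 4) (l := 3) rfl η) = 0}

/-- `B` is a special higher-order `U(1)`-instanton: `B ∧ dB ∈ Λ³₍₃₎`. -/
def IsSpecialHigherOrderInstanton (G : GTwoStructure M) (B : DiffForm M 1) : Prop :=
  B.wedge B.d ∈ G.Lambda33

/-- `B` is an anti-self-dual higher-order `U(1)`-instanton: `F_B ∧ F_B ∈ Λ⁴₍₃₎`, where `F_B = dB`
is the curvature of `B` as a connection on the trivial `U(1)`-bundle. -/
def IsAntiSelfDualHigherOrderInstanton (G : GTwoStructure M) (B : DiffForm M 1) : Prop :=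
  B.d.wedge B.d ∈ G.Lambda43

end GTwoStructure

end Manifold

end GTwo

end

/-!
The theorem rests on one fact of multilinear algebra: a special higher-order instanton satisfies
`B ∧ dB = 0`, not just the vanishing of two components of `B ∧ dB`.

Write `F = dB`, `T = B ∧ F` and `ψ = *φ`. Since `φ` is parallel for a torsion-free connection it is
closed (`GTwoStructure.IsTorsionFree.extDeriv_eq_zero`), so differentiating `φ ∧ B ∧ F = 0` gives
`φ ∧ F ∧ F = 0`. For any 1-form `B` and 2-form `F` on `ℝ⁷`, the identity
`|B ∧ F|² = |B|² *(φ ∧ F ∧ F) + (*(ψ ∧ T))² + |φ ∧ T|² - 2 ⟨ι_B F, *(φ ∧ T)⟩`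
holds. For a special instanton every term on the right is zero at each point, and so `B ∧ F = 0`
(`cyclic_eq_zero`, `wedge_eq_zero_of_special`).

Differentiating `B ∧ dB = 0` gives `dB ∧ dB = 0`, which lies in `Λ⁴₍₃₎`. If moreover `B ∧ *dB = 0`,
then at each point `B = 0` or `dB = 0` (`tensor_eq_zero`), because for `B ≠ 0`, `B ∧ F = 0` says
that `F` is divisible by `B` and `B ∧ *F = 0` that the contraction of `F` with `B` is zero. A point
with `dB ≠ 0` would therefore have a neighbourhood where `B` vanishes, and with it `dB`
(`extDeriv_eq_zero_of_smul_eq_zero`). The converse is trivial.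

Wedge products, the Hodge star and exterior derivatives are defined through sums over permutations
or multi-indices; all of them are evaluated through the alternating sums `altSum`. Statements about
`M` are transported to an open subset of `ℝ⁷` by charts, where `extDeriv` obeys the Leibniz rule
(`extDeriv_wedge`), and to `ℝ⁷` with `φ₀` by the frames of the `G₂`-structure.
-/

open scoped Topology

noncomputable section

namespace GTwo

open Equiv Filter

/-! ### Alternating sums -/

/-- The alternating sum `∑_σ sgn σ m(v ∘ σ)` of a function `m` of `n` arguments. Wedge products,
standard forms, the volume form and exterior derivatives are all such sums, up to a factor; here
`m` need not be multilinear, and `ι` may be a vector space or just the index set of a basis. -/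
def altSum {ι : Type*} {n : ℕ} (m : (Fin n → ι) → ℝ) (v : Fin n → ι) : ℝ :=
  ∑ σ : Perm (Fin n), ((Perm.sign σ : ℤ) : ℝ) * m (v ∘ σ)

section
variable {ι : Type*}

theorem sign_mul_self (n : ℕ) (σ : Perm (Fin n)) :
    ((Perm.sign σ : ℤ) : ℝ) * ((Perm.sign σ : ℤ) : ℝ) = 1 := by
  rcases Int.units_eq_one_or (Perm.sign σ) with h | h <;> simp [h]

theorem altSum_const_mul {n : ℕ} (c : ℝ) (m : (Fin n → ι) → ℝ) (v : Fin n → ι) :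
    altSum (fun w => c * m w) v = c * altSum m v := by
  simp only [altSum, Finset.mul_sum, mul_left_comm]

theorem altSum_comp_cast {n n' : ℕ} (h : n = n') (m : (Fin n → ι) → ℝ) (v : Fin n' → ι) :
    altSum m (v ∘ Fin.cast h) = altSum (fun w => m (w ∘ Fin.cast h)) v := by
  subst h
  rfl

theorem altSum_comp_perm {n : ℕ} (m : (Fin n → ι) → ℝ) (τ : Perm (Fin n)) (v : Fin n → ι) :
    altSum (fun w => m (w ∘ τ)) v = (Perm.sign τ : ℤ) * altSum m v := by
  unfold altSum
  rw [Finset.mul_sum, ← Equiv.sum_comp (Equiv.mulRight τ⁻¹)]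
  refine Finset.sum_congr rfl fun σ _ => ?_
  have : v ∘ ⇑(σ * τ⁻¹) ∘ ⇑τ = v ∘ σ := by
    ext i; simp
  simp only [Equiv.coe_mulRight, Function.comp_assoc, this]
  simp
  ring

theorem altSum_perm {n : ℕ} (m : (Fin n → ι) → ℝ) (τ : Perm (Fin n)) (v : Fin n → ι) :
    altSum m (v ∘ τ) = (Perm.sign τ : ℤ) * altSum m v := by
  unfold altSum
  rw [Finset.mul_sum, ← Equiv.sum_comp (Equiv.mulLeft τ⁻¹)]
  refine Finset.sum_congr rfl fun σ _ => ?_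
  have : (v ∘ ⇑τ) ∘ ⇑(τ⁻¹ * σ) = v ∘ σ := by
    ext i; simp
  simp only [Equiv.coe_mulLeft, this]
  simp
  ring

theorem altSum_of_alternating {n : ℕ} {m : (Fin n → ι) → ℝ} (v : Fin n → ι)
    (h : ∀ σ : Perm (Fin n), m (v ∘ σ) = (Perm.sign σ : ℤ) * m v) :
    altSum m v = n.factorial * m v := by
  unfold altSum
  simp only [h, ← mul_assoc, sign_mul_self, one_mul]
  simp [Fintype.card_perm]

/-- Laplace expansion: the term `p` collects the permutations that send `0` to `p`. -/
theorem altSum_succ {n : ℕ} (m : (Fin (n + 1) → ι) → ℝ) (v : Fin (n + 1) → ι) :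
    altSum m v = ∑ p : Fin (n + 1), (-1) ^ (p : ℕ) *
      altSum (fun w => m (Fin.cons (v p) w)) (p.removeNth v) := by
  -- Mathlib's decomposition of `Perm (Fin (n + 1))` moves `0` to `p` by a transposition; the sign
  -- `(-1) ^ p` and `removeNth` need a cycle instead. The two differ by a permutation `ρ` of the
  -- rest.
  have key : ∀ p : Fin (n + 1), ∃ ρ : Perm (Fin n), ∀ τ : Perm (Fin n),
      Perm.decomposeFin.symm (p, τ) = (Fin.cycleRange p)⁻¹ * Perm.decomposeFin.symm (0, ρ * τ) := by
    intro p
    obtain ⟨⟨q, ρ⟩, hρ⟩ := Perm.decomposeFin.symm.surjective (Fin.cycleRange p * swap 0 p)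
    have hq : q = 0 := by
      have := Perm.decomposeFin_symm_apply_zero q ρ
      rw [hρ] at this
      simpa using this.symm
    subst hq
    refine ⟨ρ, fun τ => ?_⟩
    ext i : 1
    rw [Perm.mul_apply, Perm.eq_inv_iff_eq]
    refine Fin.cases ?_ (fun j => ?_) i
    · simp
    · have h2 := congrArg (fun e => e (τ j).succ) hρ
      simp at h2
      simp [h2]
  unfold altSum
  rw [← Equiv.sum_comp Perm.decomposeFin.symm, Fintype.sum_prod_type]
  refine Finset.sum_congr rfl fun p _ => ?_
  obtain ⟨ρ, hρ⟩ := key p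
  simp only [hρ]
  refine (Equiv.sum_comp (Equiv.mulLeft ρ) (fun τ : Perm (Fin n) =>
    ((Perm.sign ((Fin.cycleRange p)⁻¹ * Perm.decomposeFin.symm (0, τ)) : ℤ) : ℝ) *
      m (v ∘ ((Fin.cycleRange p)⁻¹ * Perm.decomposeFin.symm (0, τ) : Perm (Fin (n + 1)))))).trans ?_
  rw [Finset.mul_sum]
  refine Finset.sum_congr rfl fun τ _ => ?_
  have hv : v ∘ ((Fin.cycleRange p)⁻¹ * Perm.decomposeFin.symm (0, τ) : Perm (Fin (n + 1)))
      = Fin.cons (v p) (p.removeNth v ∘ τ) := by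
    ext i
    refine Fin.cases ?_ (fun j => ?_) i
    · simp
    · simp [Fin.removeNth]
  rw [hv]
  simp [Fin.sign_cycleRange, mul_assoc]

/-- Symmetrizing `m` over any family `e` of permutations beforehand only multiplies the alternating
sum by the size of the family. -/
theorem altSum_sum_comp_perm {κ : Type*} [Fintype κ] {n : ℕ} (m : (Fin n → ι) → ℝ)
    (e : κ → Perm (Fin n)) (v : Fin n → ι) :
    altSum (fun w => ∑ t, ((Perm.sign (e t) : ℤ) : ℝ) * m (w ∘ e t)) v
      = Fintype.card κ * altSum m v := by
  have h : altSum (fun w => ∑ t, ((Perm.sign (e t) : ℤ) : ℝ) * m (w ∘ e t)) v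
      = ∑ t, ((Perm.sign (e t) : ℤ) : ℝ) * altSum (fun w => m (w ∘ e t)) v := by
    simp only [altSum, Finset.mul_sum]
    rw [Finset.sum_comm]
    exact Finset.sum_congr rfl fun _ _ => Finset.sum_congr rfl fun _ _ => by ring
  simp only [h, altSum_comp_perm, ← mul_assoc, sign_mul_self, one_mul]
  simp

/-- Alternating already over the last `l` arguments before alternating over all of them
contributes the factor `l!`. -/
theorem altSum_collapse_right {k l : ℕ} (g : (Fin k → ι) → ℝ) (h : (Fin l → ι) → ℝ)
    (v : Fin (k + l) → ι) :
    altSum (fun w => g (fun i => w (Fin.castAdd l i)) * altSum h (fun j => w (Fin.natAdd k j))) v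
      = l.factorial * altSum (fun w => g (fun i => w (Fin.castAdd l i)) *
          h (fun j => w (Fin.natAdd k j))) v := by
  have h1 := altSum_sum_comp_perm (fun w : Fin (k + l) → ι => g (fun i => w (Fin.castAdd l i)) *
    h (fun j => w (Fin.natAdd k j)))
    (fun τ : Perm (Fin l) => finSumFinEquiv.permCongr (Perm.sumCongr 1 τ)) v
  simp only [Fintype.card_perm, Fintype.card_fin] at h1
  rw [← h1]
  congr 1
  ext w
  simp [altSum, Finset.mul_sum, Perm.sign_permCongr, Equiv.permCongr_apply, Function.comp_def,
    mul_left_comm]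

/-- Alternating already over the first `k` arguments before alternating over all of them
contributes the factor `k!`. -/
theorem altSum_collapse_left {k l : ℕ} (g : (Fin k → ι) → ℝ) (h : (Fin l → ι) → ℝ)
    (v : Fin (k + l) → ι) :
    altSum (fun w => altSum g (fun i => w (Fin.castAdd l i)) * h (fun j => w (Fin.natAdd k j))) v
      = k.factorial * altSum (fun w => g (fun i => w (Fin.castAdd l i)) *
          h (fun j => w (Fin.natAdd k j))) v := by
  have h1 := altSum_sum_comp_perm (fun w : Fin (k + l) → ι => g (fun i => w (Fin.castAdd l i)) *
    h (fun j => w (Fin.natAdd k j)))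
    (fun τ : Perm (Fin k) => finSumFinEquiv.permCongr (Perm.sumCongr τ 1)) v
  simp only [Fintype.card_perm, Fintype.card_fin] at h1
  rw [← h1]
  congr 1
  ext w
  simp [altSum, Finset.sum_mul, Perm.sign_permCongr, Equiv.permCongr_apply, Function.comp_def,
    mul_assoc]

end

/-! ### The wedge product in terms of alternating sums -/

section
variable {V : Type*} [AddCommGroup V] [Module ℝ V] [TopologicalSpace V]

theorem map_comp_perm {n : ℕ} (α : V [⋀^Fin n]→L[ℝ] ℝ) (v : Fin n → V) (σ : Perm (Fin n)) :
    α (v ∘ σ) = (Perm.sign σ : ℤ) * α v := by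
  have := α.toAlternatingMap.map_perm v σ
  rcases Int.units_eq_one_or (Perm.sign σ) with h | h <;> simpa [h] using this

theorem altSum_apply_form {n : ℕ} (α : V [⋀^Fin n]→L[ℝ] ℝ) (v : Fin n → V) :
    altSum (fun w => α w) v = n.factorial * α v :=
  altSum_of_alternating v (map_comp_perm α v)

theorem wedge_apply {k l : ℕ} (α : V [⋀^Fin k]→L[ℝ] ℝ) (β : V [⋀^Fin l]→L[ℝ] ℝ)
    (v : Fin (k + l) → V) :
    wedge α β v = ((k.factorial : ℝ) * l.factorial)⁻¹ *
      altSum (fun w => α (fun i => w (Fin.castAdd l i)) * β (fun j => w (Fin.natAdd k j))) v := by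
  simp only [wedge, ContinuousAlternatingMap.smul_apply, smul_eq_mul, altSum,
    ContinuousMultilinearMap.alternatization_apply_apply]
  congr 1
  refine Finset.sum_congr rfl fun σ _ => ?_
  have : tensorForm α β (v ∘ σ) = α (fun i => (v ∘ σ) (Fin.castAdd l i)) *
    β (fun j => (v ∘ σ) (Fin.natAdd k j)) := rfl
  rcases Int.units_eq_one_or (Perm.sign σ) with h | h <;> simp [h, this]

theorem wedge_zero_right {k l : ℕ} (α : V [⋀^Fin k]→L[ℝ] ℝ) :
    wedge α (0 : V [⋀^Fin l]→L[ℝ] ℝ) = 0 := by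
  ext v; simp [wedge_apply, altSum]

theorem wedge_zero_left {k l : ℕ} (β : V [⋀^Fin l]→L[ℝ] ℝ) :
    wedge (0 : V [⋀^Fin k]→L[ℝ] ℝ) β = 0 := by
  ext v; simp [wedge_apply, altSum]

theorem wedge_add_left {k l : ℕ} (α α' : V [⋀^Fin k]→L[ℝ] ℝ) (β : V [⋀^Fin l]→L[ℝ] ℝ) :
    wedge (α + α') β = wedge α β + wedge α' β := by
  ext v
  simp [wedge_apply, altSum, add_mul, mul_add, Finset.sum_add_distrib]

theorem wedge_sub_left {k l : ℕ} (α α' : V [⋀^Fin k]→L[ℝ] ℝ) (β : V [⋀^Fin l]→L[ℝ] ℝ) :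
    wedge (α - α') β = wedge α β - wedge α' β := by
  ext v
  simp [wedge_apply, altSum, sub_mul, mul_sub, Finset.sum_sub_distrib]

theorem wedge_compContinuousLinearMap {W : Type*} [AddCommGroup W] [Module ℝ W]
    [TopologicalSpace W] {k l : ℕ} (α : V [⋀^Fin k]→L[ℝ] ℝ) (β : V [⋀^Fin l]→L[ℝ] ℝ)
    (A : W →L[ℝ] V) :
    (wedge α β).compContinuousLinearMap A =
      wedge (α.compContinuousLinearMap A) (β.compContinuousLinearMap A) := by
  ext v
  simp [wedge_apply, altSum, Function.comp_def]

/-- Wedge product with a 1-form. The vectors are given twice, as `v'` and as its reindexing `v`,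
because `1 + l` and `l + 1` are not definitionally equal. -/
theorem wedge_one_apply {l : ℕ} (β : V [⋀^Fin 1]→L[ℝ] ℝ) (η : V [⋀^Fin l]→L[ℝ] ℝ)
    (v : Fin (l + 1) → V) (v' : Fin (1 + l) → V)
    (hv : ∀ i, v' i = v (Fin.cast (Nat.add_comm 1 l) i)) :
    wedge β η v' =
      ∑ p : Fin (l + 1), (-1) ^ (p : ℕ) * (β (fun _ => v p) * η (p.removeNth v)) := by
  obtain rfl : v' = v ∘ Fin.cast (Nat.add_comm 1 l) := funext hv
  rw [wedge_apply, altSum_comp_cast, altSum_succ, Finset.mul_sum]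
  refine Finset.sum_congr rfl fun p _ => ?_
  have h : ∀ w : Fin l → V,
      β (fun i => ((Fin.cons (v p) w : Fin (l + 1) → V) ∘ Fin.cast (Nat.add_comm 1 l))
        (Fin.castAdd l i)) *
      η (fun j => ((Fin.cons (v p) w : Fin (l + 1) → V) ∘ Fin.cast (Nat.add_comm 1 l))
        (Fin.natAdd 1 j)) = β (fun _ => v p) * η w := by
    intro w
    congr 2
    · ext i
      have : Fin.cast (Nat.add_comm 1 l) (Fin.castAdd l i) = 0 := by
        ext; simp
      simp only [Function.comp_apply, this, Fin.cons_zero]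
    · ext j
      have : Fin.cast (Nat.add_comm 1 l) (Fin.natAdd 1 j) = j.succ := by
        ext; simp
      simp only [Function.comp_apply, this, Fin.cons_succ]
  simp only [h, altSum_const_mul, altSum_apply_form]
  have := Nat.cast_ne_zero (R := ℝ).2 l.factorial_ne_zero
  field_simp
  simp

end

/-! ### Forms on `ℝ⁷` in the standard basis -/

theorem form_ext {n : ℕ} {α β : E7 [⋀^Fin n]→L[ℝ] ℝ}
    (h : ∀ f : Fin n → Fin 7, α (stdVec ∘ f) = β (stdVec ∘ f)) : α = β := by
  apply ContinuousAlternatingMap.toAlternatingMap_injective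
  refine Module.Basis.ext_alternating (EuclideanSpace.basisFun (Fin 7) ℝ).toBasis fun f _ => ?_
  have h2 : (fun i => (EuclideanSpace.basisFun (Fin 7) ℝ).toBasis (f i)) = stdVec ∘ f := by
    ext i; simp [stdVec]
  rw [h2]
  exact h f

/-- On basis vectors, `e^t` counts with signs the permutations that carry the multi-index `f`
to `t`. -/
theorem stdForm_stdVec {k : ℕ} (t f : Fin k → Fin 7) :
    stdForm t (stdVec ∘ f) = altSum (fun w : Fin k → Fin 7 => if w = t then (1 : ℝ) else 0) f := by
  simp only [stdForm, altSum, ContinuousMultilinearMap.alternatization_apply_apply]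
  refine Finset.sum_congr rfl fun σ _ => ?_
  have : ∏ i, (stdVec (f (σ i))) (t i) = if f ∘ σ = t then (1 : ℝ) else 0 := by
    by_cases h : f ∘ σ = t
    · rw [if_pos h]
      refine Finset.prod_eq_one fun i _ => ?_
      simp [stdVec, ← h]
    · rw [if_neg h]
      obtain ⟨i, hi⟩ := Function.ne_iff.1 h
      exact Finset.prod_eq_zero (Finset.mem_univ i) (by simpa [stdVec] using fun e => hi e.symm)
  simp only [Function.comp_def] at this ⊢
  rcases Int.units_eq_one_or (Perm.sign σ) with h | h <;> simp [h, this]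

theorem stdForm_stdVec_comm {k : ℕ} (t f : Fin k → Fin 7) :
    stdForm t (stdVec ∘ f) = stdForm f (stdVec ∘ t) := by
  rw [stdForm_stdVec, stdForm_stdVec, altSum, altSum, ← Equiv.sum_comp (Equiv.inv _)]
  refine Finset.sum_congr rfl fun σ _ => ?_
  have : f ∘ ⇑(σ⁻¹) = t ↔ t ∘ σ = f := by
    constructor <;> (rintro rfl; ext i; simp)
  rw [Equiv.inv_apply, Perm.sign_inv]
  simp only [this]

theorem vol0_perm (σ : Perm (Fin 7)) : vol0 (stdVec ∘ σ) = (Perm.sign σ : ℤ) := by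
  rw [map_comp_perm]
  have : vol0 stdVec = 1 := by
    rw [vol0, ← Function.comp_id stdVec, stdForm_stdVec, altSum, Finset.sum_eq_single 1]
    · simp
    · intro σ _ h
      have : ¬ (⇑σ = id) := fun e => h (Equiv.ext (congrFun e))
      simp [this]
    · simp
  simp [this]

/-! ### The Hodge star on `ℝ⁷` -/

/-- The star of `β` on basis vectors, as a sum over multi-indices. -/
theorem star0_apply {k l : ℕ} (h : k + l = 7) (β : E7 [⋀^Fin k]→L[ℝ] ℝ) (r : Fin l → Fin 7) :
    star0 h β (stdVec ∘ r) = (k.factorial : ℝ)⁻¹ * ∑ f : Fin k → Fin 7,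
      β (stdVec ∘ f) * vol0 (stdVec ∘ Fin.append f r ∘ Fin.cast h.symm) := by
  have : ∀ f : Fin k → Fin 7, interior h vol0 (fun a => stdVec (f a)) (stdVec ∘ r) =
      vol0 (stdVec ∘ Fin.append f r ∘ Fin.cast h.symm) := by
    intro f
    change vol0 _ = vol0 _
    congr 1
    ext1 i
    simp only [Function.comp_apply]
    refine Fin.addCases (fun a => ?_) (fun b => ?_) (Fin.cast h.symm i) <;> simp
  simp only [star0, ContinuousAlternatingMap.smul_apply, smul_eq_mul,
    ContinuousAlternatingMap.sum_apply, this]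
  rfl

/-- A function of multi-indices that is supported on the rearrangements of `a`, and takes one value
`c` on them, has sum `k! c`. -/
theorem sum_eq_of_comp_perm {ι : Type*} [Fintype ι] [DecidableEq ι] {k : ℕ} {a : Fin k → ι}
    (ha : Function.Injective a) (g : (Fin k → ι) → ℝ) (c : ℝ)
    (h0 : ∀ f, g f ≠ 0 → ∃ τ : Perm (Fin k), a ∘ τ = f)
    (hc : ∀ τ : Perm (Fin k), g (a ∘ τ) = c) : ∑ f, g f = k.factorial * c := by
  have h : ∑ _τ : Perm (Fin k), c = ∑ f, g f := by
    refine Finset.sum_of_injOn (fun τ : Perm (Fin k) => a ∘ τ) ?_ (by simp) ?_ ?_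
    · intro τ _ τ' _ hτ
      ext i : 1
      exact ha (congrFun hτ i)
    · intro f _ hf
      by_contra hne
      obtain ⟨τ, hτ⟩ := h0 f hne
      exact hf ⟨τ, by simp, hτ⟩
    · intro τ _
      exact (hc τ).symm
  rw [← h]
  simp [Fintype.card_perm]

/-- For a permutation `ρ`, the star of `β` on the last `l` vectors of the basis `e_ρ` is
`sgn ρ` times `β` on its first `k` vectors: `* e^{ρ(1) … ρ(k)} = sgn ρ e^{ρ(k+1) … ρ(7)}`. -/
theorem star0_perm {k l : ℕ} (h : k + l = 7) (β : E7 [⋀^Fin k]→L[ℝ] ℝ) (ρ : Perm (Fin 7))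
    {v : Fin l → E7} {w : Fin k → E7} (hv : ∀ j, v j = stdVec (ρ (Fin.cast h (Fin.natAdd k j))))
    (hw : ∀ i, w i = stdVec (ρ (Fin.cast h (Fin.castAdd l i)))) :
    star0 h β v = (Perm.sign ρ : ℤ) * β w := by
  obtain rfl : v = stdVec ∘ fun j => ρ (Fin.cast h (Fin.natAdd k j)) := funext hv
  obtain rfl : w = stdVec ∘ fun i => ρ (Fin.cast h (Fin.castAdd l i)) := funext hw
  set a : Fin k → Fin 7 := fun i => ρ (Fin.cast h (Fin.castAdd l i)) with ha
  set r : Fin l → Fin 7 := fun j => ρ (Fin.cast h (Fin.natAdd k j)) with hr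
  have hinj : Function.Injective a := fun i j hij => by simpa [ha] using hij
  rw [star0_apply]
  rw [sum_eq_of_comp_perm hinj _ (((Perm.sign ρ : ℤ) : ℝ) * β (stdVec ∘ a)) ?_ ?_]
  · have := Nat.cast_ne_zero (R := ℝ).2 k.factorial_ne_zero
    field_simp
  · intro f hne
    have hfr : Function.Injective (Fin.append f r) := by
      intro i j hij
      by_contra hc
      refine hne (mul_eq_zero_of_right _ (vol0.map_eq_zero_of_eq _ (i := Fin.cast h i)
        (j := Fin.cast h j) (by simp [hij]) ?_))
      simpa using hc
    have hex : ∀ i, ∃ j, a j = f i := by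
      intro i
      obtain ⟨x, hx⟩ := ρ.surjective (f i)
      obtain ⟨x, rfl⟩ := (finCongr h).surjective x
      revert hx
      refine Fin.addCases (fun j hx => ⟨j, hx⟩) (fun j hx => ?_) x
      have : Fin.append f r (Fin.natAdd k j) = Fin.append f r (Fin.castAdd l i) := by
        simpa [hr] using hx
      have := congrArg Fin.val (hfr this)
      simp at this
      omega
    choose τ hτ using hex
    have hτi : Function.Injective τ := by
      intro i j hij
      have h1 : Fin.append f r (Fin.castAdd l i) = Fin.append f r (Fin.castAdd l j) := by
        simp [← hτ, hij]
      exact Fin.castAdd_injective _ _ (hfr h1)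
    exact ⟨Equiv.ofBijective τ (Finite.injective_iff_bijective.1 hτi), funext fun i => hτ i⟩
  · intro τ
    let π : Perm (Fin 7) := (finSumFinEquiv.trans (finCongr h)).permCongr (Perm.sumCongr τ 1)
    have hs : Perm.sign π = Perm.sign τ := by simp [π, Perm.sign_permCongr]
    have hπ : Fin.append (a ∘ τ) r ∘ Fin.cast h.symm = ⇑(ρ * π) := by
      ext1 i
      obtain ⟨i, rfl⟩ := (finCongr h).surjective i
      refine Fin.addCases (fun j => ?_) (fun j => ?_) i <;>
        simp [π, Equiv.permCongr_apply, ha, hr]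
    rw [hπ, vol0_perm, ← Function.comp_assoc, map_comp_perm, Perm.sign_mul, hs]
    rcases Int.units_eq_one_or (Perm.sign τ) with h | h <;> simp [h, mul_comm]

/-- The coordinates of `β ∧ *F`: up to sign, `β ∧ *F` is the star of the contraction of `F` with the
vector dual to `β`. -/
theorem wedge_star0_succAbove (β : E7 [⋀^Fin 1]→L[ℝ] ℝ) (F : E7 [⋀^Fin 2]→L[ℝ] ℝ) (i : Fin 7) :
    wedge β (star0 (k := 2) (l := 5) rfl F) (stdVec ∘ i.succAbove) =
      (-1) ^ (i : ℕ) * ∑ j, β (fun _ => stdVec j) * F ![stdVec i, stdVec j] := by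
  have h0 : F ![stdVec i, stdVec i] = 0 :=
    F.map_eq_zero_of_eq _ (i := 0) (j := 1) (by simp) (by simp)
  rw [Fin.sum_univ_succAbove _ i, h0, mul_zero, zero_add]
  rw [wedge_one_apply β (star0 (k := 2) (l := 5) rfl F) (stdVec ∘ i.succAbove)
      (stdVec ∘ i.succAbove) (fun _ => rfl),
    Finset.mul_sum]
  refine Finset.sum_congr rfl fun p _ => ?_
  -- `ρ` lists first `i`, then `i.succAbove p`, then the remaining indices in order.
  let ρ : Perm (Fin 7) := (Fin.cycleRange i)⁻¹ *
    Perm.decomposeFin.symm (0, (Fin.cycleRange p)⁻¹)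
  have hs : ((Perm.sign ρ : ℤ) : ℝ) = (-1) ^ (i : ℕ) * (-1) ^ (p : ℕ) := by
    simp [ρ, Fin.sign_cycleRange]
  have hi0 : (Fin.cycleRange i)⁻¹ 0 = i := by rw [Perm.inv_eq_iff_eq]; simp
  have his : ∀ j : Fin 6, (Fin.cycleRange i)⁻¹ j.succ = i.succAbove j := by
    intro j; rw [Perm.inv_eq_iff_eq]; simp
  have hp0 : (Fin.cycleRange p)⁻¹ 0 = p := by rw [Perm.inv_eq_iff_eq]; simp
  have hps : ∀ j : Fin 5, (Fin.cycleRange p)⁻¹ j.succ = p.succAbove j := by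
    intro j; rw [Perm.inv_eq_iff_eq]; simp
  have hρ0 : ρ 0 = i := by
    simp only [ρ, Perm.mul_apply, Perm.decomposeFin_symm_apply_zero, hi0]
  have hρs : ∀ j : Fin 6, ρ j.succ = i.succAbove ((Fin.cycleRange p)⁻¹ j) := by
    intro j
    simp only [ρ, Perm.mul_apply, Perm.decomposeFin_symm_apply_succ, swap_self, Equiv.refl_apply,
      his]
  have hρ1 : ρ 1 = i.succAbove p := by
    rw [← hp0]; exact hρs 0
  have h1 : star0 (k := 2) (l := 5) rfl F (p.removeNth (stdVec ∘ i.succAbove)) =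
      (Perm.sign ρ : ℤ) * F ![stdVec i, stdVec (i.succAbove p)] := by
    refine star0_perm _ F ρ (fun j => ?_) (fun j => ?_)
    · have : Fin.cast (rfl : 2 + 5 = 7) (Fin.natAdd 2 j) = j.succ.succ := by
        ext; simp; omega
      simp only [Function.comp_apply, this, hρs, hps, Fin.removeNth]
    · fin_cases j
      · exact congrArg stdVec hρ0.symm
      · exact congrArg stdVec hρ1.symm
  have h4 : ((-1 : ℝ) ^ (p : ℕ)) * (-1) ^ (p : ℕ) = 1 := by
    rw [← mul_pow]; simp
  refine (congrArg (fun t => (-1) ^ (p : ℕ) * (β (fun _ => stdVec (i.succAbove p)) * t))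
    h1).trans ?_
  rw [hs]
  linear_combination ((-1) ^ (i : ℕ) * (β fun _ => stdVec (i.succAbove p)) *
    F ![stdVec i, stdVec (i.succAbove p)]) * h4

/-! ### Wedge products and stars of standard forms -/

/-- The function `g` of the arguments after the first if the first argument is the index `t`, and
`0` otherwise. For an alternating form `g`, the alternating sum of `contr t₁ (… (contr tₖ g))` is
`e^{t₁ … tₖ} ∧ g` on basis vectors, up to the factor `l!`, where `l` is the degree of `g`. -/
def contr {n : ℕ} (t : Fin 7) (g : (Fin n → Fin 7) → ℝ) (w : Fin (n + 1) → Fin 7) : ℝ :=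
  if w 0 = t then g (Fin.tail w) else 0

theorem altSum_contr {n : ℕ} (t : Fin 7) (g : (Fin n → Fin 7) → ℝ) (f : Fin (n + 1) → Fin 7) :
    altSum (contr t g) f = ∑ p : Fin (n + 1),
      if f p = t then (-1) ^ (p : ℕ) * altSum g (p.removeNth f) else 0 := by
  rw [altSum_succ]
  refine Finset.sum_congr rfl fun p _ => ?_
  by_cases h : f p = t <;> simp [contr, h, altSum]

/-- If the index `t` occurs exactly once in `f`, in position `p`, the alternating sum of `contr t g`
strikes it out, with the sign of its position. The specializations to `p ≤ 4` below are rewriting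
rules that evaluate iterated contractions on explicit lists. -/
theorem altSum_contr_eq {n : ℕ} {t : Fin 7} (g : (Fin n → Fin 7) → ℝ) {f : Fin (n + 1) → Fin 7}
    (p : Fin (n + 1)) (hp : f p = t) (h : ∀ q, q ≠ p → f q ≠ t) :
    altSum (contr t g) f = (-1) ^ (p : ℕ) * altSum g (p.removeNth f) := by
  rw [altSum_contr, Finset.sum_eq_single p]
  · simp [hp]
  · intro q _ hq
    simp [h q hq]
  · simp

theorem altSum_contr_eq_zero {n : ℕ} {t : Fin 7} (g : (Fin n → Fin 7) → ℝ)
    {f : Fin (n + 1) → Fin 7} (h : ∀ q, f q ≠ t) : altSum (contr t g) f = 0 := by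
  rw [altSum_contr]
  exact Finset.sum_eq_zero fun q _ => by simp [h q]

theorem removeNth_succ_vecCons {ι : Type*} {n : ℕ} (p : Fin (n + 1)) (a : ι)
    (v : Fin (n + 1) → ι) :
    Fin.removeNth p.succ (Matrix.vecCons a v) = Matrix.vecCons a (Fin.removeNth p v) := by
  ext i
  refine Fin.cases ?_ (fun j => ?_) i <;> simp [Fin.removeNth]

theorem removeNth_zero_vecCons {ι : Type*} {n : ℕ} (a : ι) (v : Fin n → ι) :
    Fin.removeNth 0 (Matrix.vecCons a v) = v := rfl

section

variable {n : ℕ} (a b c d t : Fin 7) (v : Fin n → Fin 7)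

theorem altSum_contr_zero (g : (Fin n → Fin 7) → ℝ)
    (h : ∀ q, q ≠ 0 → (Matrix.vecCons t v) q ≠ t) :
    altSum (contr t g) (Matrix.vecCons t v) = altSum g v := by
  rw [altSum_contr_eq g 0 (by simp) h]
  simp only [removeNth_zero_vecCons]
  simp

theorem altSum_contr_one (g : (Fin (n + 1) → Fin 7) → ℝ)
    (h : ∀ q, q ≠ (0 : Fin (n + 1)).succ →
      (Matrix.vecCons a (Matrix.vecCons t v)) q ≠ t) :
    altSum (contr t g)
        (Matrix.vecCons a (Matrix.vecCons t v)) =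
      -altSum g (Matrix.vecCons a v) := by
  rw [altSum_contr_eq g ((0 : Fin (n + 1)).succ) (by simp) h]
  simp only [removeNth_succ_vecCons, removeNth_zero_vecCons, Fin.val_succ, Fin.val_zero]
  ring

theorem altSum_contr_two (g : (Fin (n + 2) → Fin 7) → ℝ)
    (h : ∀ q, q ≠ (0 : Fin (n + 1)).succ.succ →
      (Matrix.vecCons a (Matrix.vecCons b (Matrix.vecCons t v))) q ≠ t) :
    altSum (contr t g)
        (Matrix.vecCons a (Matrix.vecCons b (Matrix.vecCons t v))) =
      altSum g (Matrix.vecCons a (Matrix.vecCons b v)) := by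
  rw [altSum_contr_eq g ((0 : Fin (n + 1)).succ.succ) (by simp) h]
  simp only [removeNth_succ_vecCons, removeNth_zero_vecCons, Fin.val_succ, Fin.val_zero]
  ring

theorem altSum_contr_three (g : (Fin (n + 3) → Fin 7) → ℝ)
    (h : ∀ q, q ≠ (0 : Fin (n + 1)).succ.succ.succ →
      (Matrix.vecCons a (Matrix.vecCons b (Matrix.vecCons c (Matrix.vecCons t v)))) q ≠ t) :
    altSum (contr t g)
        (Matrix.vecCons a (Matrix.vecCons b (Matrix.vecCons c (Matrix.vecCons t v)))) =
      -altSum g (Matrix.vecCons a (Matrix.vecCons b (Matrix.vecCons c v))) := by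
  rw [altSum_contr_eq g ((0 : Fin (n + 1)).succ.succ.succ) (by simp) h]
  simp only [removeNth_succ_vecCons, removeNth_zero_vecCons, Fin.val_succ, Fin.val_zero]
  ring

theorem altSum_contr_four (g : (Fin (n + 4) → Fin 7) → ℝ)
    (h : ∀ q, q ≠ (0 : Fin (n + 1)).succ.succ.succ.succ →
      (Matrix.vecCons a
        (Matrix.vecCons b (Matrix.vecCons c (Matrix.vecCons d (Matrix.vecCons t v))))) q ≠ t) :
    altSum (contr t g)
        (Matrix.vecCons a
          (Matrix.vecCons b (Matrix.vecCons c (Matrix.vecCons d (Matrix.vecCons t v))))) =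
      altSum g (Matrix.vecCons a (Matrix.vecCons b (Matrix.vecCons c (Matrix.vecCons d v)))) := by
  rw [altSum_contr_eq g ((0 : Fin (n + 1)).succ.succ.succ.succ) (by simp) h]
  simp only [removeNth_succ_vecCons, removeNth_zero_vecCons, Fin.val_succ, Fin.val_zero]
  ring

end

theorem wedge_stdForm {k l : ℕ} (t : Fin k → Fin 7) (β : E7 [⋀^Fin l]→L[ℝ] ℝ)
    (f : Fin (k + l) → Fin 7) :
    wedge (stdForm t) β (stdVec ∘ f) = (l.factorial : ℝ)⁻¹ *
      altSum (fun w : Fin (k + l) → Fin 7 => if (fun i => w (Fin.castAdd l i)) = t then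
        β (stdVec ∘ fun j => w (Fin.natAdd k j)) else 0) f := by
  have h : altSum (fun w => stdForm t (fun i => w (Fin.castAdd l i)) *
      β (fun j => w (Fin.natAdd k j))) (stdVec ∘ f) =
      altSum (fun w => altSum (fun u : Fin k → Fin 7 => if u = t then (1 : ℝ) else 0)
        (fun i => w (Fin.castAdd l i)) * β (stdVec ∘ fun j => w (Fin.natAdd k j))) f := by
    simp only [← stdForm_stdVec]
    rfl
  rw [wedge_apply, h, altSum_collapse_left _ (fun w => β (stdVec ∘ w))]
  have := Nat.cast_ne_zero (R := ℝ).2 k.factorial_ne_zero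
  simp only [ite_mul, one_mul, zero_mul]
  field_simp

/-- The product `e^{abc} ∧ β` on basis vectors as an iterated contraction; `f` is `f'` reindexed. -/
theorem wedge_stdForm_three {l : ℕ} (a b c : Fin 7) (β : E7 [⋀^Fin l]→L[ℝ] ℝ)
    (f' : Fin (3 + l) → Fin 7) (f : Fin (l + 1 + 1 + 1) → Fin 7) (h : 3 + l = l + 1 + 1 + 1)
    (hf : ∀ i, f' i = f (Fin.cast h i)) :
    wedge (stdForm ![a, b, c]) β (stdVec ∘ f') = (l.factorial : ℝ)⁻¹ *
      altSum (contr a (contr b (contr c fun w => β (stdVec ∘ w)))) f := by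
  obtain rfl : f' = f ∘ Fin.cast h := funext hf
  rw [wedge_stdForm, altSum_comp_cast]
  congr 2
  ext w
  have h1 : (fun i => (w ∘ Fin.cast h) (Fin.castAdd l i)) = ![a, b, c] ↔
      w 0 = a ∧ w 1 = b ∧ w 2 = c := by
    rw [funext_iff, Fin.forall_fin_succ, Fin.forall_fin_succ, Fin.forall_fin_succ]
    simp
    rfl
  have h2 : (fun j => (w ∘ Fin.cast h) (Fin.natAdd 3 j)) = Fin.tail (Fin.tail (Fin.tail w)) := by
    ext1 j
    simp only [Fin.tail, Function.comp_apply]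
    congr 1
    ext
    simp only [Fin.val_cast, Fin.val_natAdd, Fin.val_succ]
    omega
  rw [h2]
  simp only [h1, contr, ite_and]
  rfl

theorem wedge_phi0_apply {l : ℕ} (β : E7 [⋀^Fin l]→L[ℝ] ℝ)
    (f' : Fin (3 + l) → Fin 7) (f : Fin (l + 1 + 1 + 1) → Fin 7) (h : 3 + l = l + 1 + 1 + 1)
    (hf : ∀ i, f' i = f (Fin.cast h i)) :
    l.factorial * wedge phi0 β (stdVec ∘ f') =
      altSum (contr 0 (contr 1 (contr 2 fun w => β (stdVec ∘ w)))) f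
      + altSum (contr 0 (contr 3 (contr 4 fun w => β (stdVec ∘ w)))) f
      + altSum (contr 1 (contr 3 (contr 5 fun w => β (stdVec ∘ w)))) f
      + altSum (contr 2 (contr 3 (contr 6 fun w => β (stdVec ∘ w)))) f
      - altSum (contr 0 (contr 5 (contr 6 fun w => β (stdVec ∘ w)))) f
      + altSum (contr 1 (contr 4 (contr 6 fun w => β (stdVec ∘ w)))) f
      - altSum (contr 2 (contr 4 (contr 5 fun w => β (stdVec ∘ w)))) f := by
  have := Nat.cast_ne_zero (R := ℝ).2 l.factorial_ne_zero
  simp only [phi0, wedge_add_left, wedge_sub_left, ContinuousAlternatingMap.add_apply,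
    ContinuousAlternatingMap.sub_apply, wedge_stdForm_three _ _ _ β f' f h hf]
  field_simp

theorem altSum_form_stdVec {n : ℕ} (α : E7 [⋀^Fin n]→L[ℝ] ℝ) (f : Fin n → Fin 7) :
    altSum (fun w => α (stdVec ∘ w)) f = n.factorial * α (stdVec ∘ f) :=
  altSum_apply_form α (stdVec ∘ f)

theorem wedge_stdForm_four {l : ℕ} (a b c d : Fin 7) (β : E7 [⋀^Fin l]→L[ℝ] ℝ)
    (f' : Fin (4 + l) → Fin 7) (f : Fin (l + 1 + 1 + 1 + 1) → Fin 7)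
    (h : 4 + l = l + 1 + 1 + 1 + 1) (hf : ∀ i, f' i = f (Fin.cast h i)) :
    l.factorial * wedge (stdForm ![a, b, c, d]) β (stdVec ∘ f') =
      altSum (contr a (contr b (contr c (contr d fun w => β (stdVec ∘ w))))) f := by
  obtain rfl : f' = f ∘ Fin.cast h := funext hf
  have := Nat.cast_ne_zero (R := ℝ).2 l.factorial_ne_zero
  rw [wedge_stdForm, altSum_comp_cast, mul_inv_cancel_left₀ this]
  congr 1
  ext w
  have h1 : (fun i => (w ∘ Fin.cast h) (Fin.castAdd l i)) = ![a, b, c, d] ↔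
      w 0 = a ∧ w 1 = b ∧ w 2 = c ∧ w 3 = d := by
    rw [funext_iff, Fin.forall_fin_succ, Fin.forall_fin_succ, Fin.forall_fin_succ,
      Fin.forall_fin_succ]
    simp
    rfl
  have h2 : (fun j => (w ∘ Fin.cast h) (Fin.natAdd 4 j)) =
      Fin.tail (Fin.tail (Fin.tail (Fin.tail w))) := by
    ext1 j
    simp only [Fin.tail, Function.comp_apply]
    congr 1
    ext
    simp only [Fin.val_cast, Fin.val_natAdd, Fin.val_succ]
    omega
  rw [h2]
  simp only [h1, contr, ite_and]
  rfl

theorem star0_stdForm {k l : ℕ} (h : k + l = 7) {t : Fin k → Fin 7} (ht : Function.Injective t)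
    (r : Fin l → Fin 7) :
    star0 h (stdForm t) (stdVec ∘ r) = vol0 (stdVec ∘ Fin.append t r ∘ Fin.cast h.symm) := by
  have ht1 : ∀ τ : Perm (Fin k), stdForm t (stdVec ∘ t ∘ τ) = (Perm.sign τ : ℤ) := by
    intro τ
    rw [stdForm_stdVec_comm, stdForm_stdVec, altSum, Finset.sum_eq_single τ]
    · simp
    · intro σ _ hσ
      have : ¬ (t ∘ σ = t ∘ τ) := fun e => hσ (Equiv.ext fun i => ht (congrFun e i))
      simp [this]
    · simp
  rw [star0_apply, sum_eq_of_comp_perm ht _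
    (vol0 (stdVec ∘ Fin.append t r ∘ Fin.cast h.symm)) ?_ ?_]
  · have := Nat.cast_ne_zero (R := ℝ).2 k.factorial_ne_zero
    field_simp
  · intro f hf
    have hne := left_ne_zero_of_mul hf
    rw [stdForm_stdVec_comm, stdForm_stdVec, altSum] at hne
    obtain ⟨σ, _, hσ⟩ := Finset.exists_ne_zero_of_sum_ne_zero hne
    refine ⟨σ, ?_⟩
    by_contra hc
    simp [hc] at hσ
  · intro τ
    let π : Perm (Fin 7) := (finSumFinEquiv.trans (finCongr h)).permCongr (Perm.sumCongr τ 1)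
    have hs : Perm.sign π = Perm.sign τ := by simp [π, Perm.sign_permCongr]
    have hπ : stdVec ∘ Fin.append (t ∘ τ) r ∘ Fin.cast h.symm =
        (stdVec ∘ Fin.append t r ∘ Fin.cast h.symm) ∘ π := by
      ext1 i
      obtain ⟨i, rfl⟩ := (finCongr h).surjective i
      refine Fin.addCases (fun j => ?_) (fun j => ?_) i <;>
        simp [π, Equiv.permCongr_apply]
    rw [ht1, hπ, map_comp_perm, hs, ← mul_assoc, sign_mul_self, one_mul]

/-- The volume form on `e_a, e_b, e_c, e_{r(1)}, …, e_{r(4)}`, with the roles of the two lists of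
indices exchanged: now `a, b, c` are struck out from `0, …, 6` and the rest is compared with `r`. -/
theorem vol0_stdVec_eq {a b c : Fin 7} {r : Fin 4 → Fin 7} {u : Fin 7 → Fin 7}
    (h0 : u 0 = a) (h1 : u 1 = b) (h2 : u 2 = c) (hr : ∀ j : Fin 4, u j.succ.succ.succ = r j) :
    vol0 (stdVec ∘ u) =
      altSum (contr a (contr b (contr c fun w => if w = r then (1 : ℝ) else 0)))
        ![0, 1, 2, 3, 4, 5, 6] := by
  have hid : (id : Fin 7 → Fin 7) = ![0, 1, 2, 3, 4, 5, 6] := by decide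
  rw [vol0, stdForm_stdVec_comm, stdForm_stdVec, hid]
  congr 1
  ext w
  have hw : w = u ↔ w 0 = a ∧ w 1 = b ∧ w 2 = c ∧ Fin.tail (Fin.tail (Fin.tail w)) = r := by
    simp only [funext_iff, Fin.forall_fin_succ (n := 6), Fin.forall_fin_succ (n := 5),
      Fin.forall_fin_succ (n := 4), Fin.tail, hr]
    simp [h0, h1, h2]
  simp only [contr, ite_and, hw]
  rfl

theorem star0_stdForm_three (h : 3 + 4 = 7) {t : Fin 3 → Fin 7} (ht : Function.Injective t)
    (r : Fin 4 → Fin 7) :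
    star0 h (stdForm t) (stdVec ∘ r) =
      altSum (contr (t 0) (contr (t 1) (contr (t 2) fun w => if w = r then (1 : ℝ) else 0)))
        ![0, 1, 2, 3, 4, 5, 6] := by
  rw [star0_stdForm h ht]
  refine vol0_stdVec_eq (Fin.append_left t r 0) (Fin.append_left t r 1) (Fin.append_left t r 2)
    fun j => ?_
  rw [← Fin.append_right t r j, Function.comp_apply]
  congr 1
  ext
  simp only [Fin.val_cast, Fin.val_natAdd, Fin.val_succ]
  omega

theorem star0_add {k l : ℕ} (h : k + l = 7) (α β : E7 [⋀^Fin k]→L[ℝ] ℝ) :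
    star0 h (α + β) = star0 h α + star0 h β := by
  simp [star0, add_smul, Finset.sum_add_distrib]

theorem star0_sub {k l : ℕ} (h : k + l = 7) (α β : E7 [⋀^Fin k]→L[ℝ] ℝ) :
    star0 h (α - β) = star0 h α - star0 h β := by
  ext v
  simp [star0, sub_mul, mul_sub, Finset.sum_sub_distrib]

theorem star0_zero {k l : ℕ} (h : k + l = 7) :
    star0 h (0 : E7 [⋀^Fin k]→L[ℝ] ℝ) = 0 := by
  simp [star0]

/-! ### Wedge products with `φ₀` and `*φ₀` in coordinates -/

/-- The 4-form `ψ₀ = *φ₀`. -/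
theorem star0_phi0 : star0 (k := 3) (l := 4) rfl phi0 =
    stdForm ![3, 4, 5, 6] + stdForm ![1, 2, 5, 6] + stdForm ![0, 2, 4, 6] + stdForm ![0, 1, 4, 5]
      - stdForm ![1, 2, 3, 4] + stdForm ![0, 2, 3, 5] - stdForm ![0, 1, 3, 6] := by
  simp only [phi0, star0_add, star0_sub]
  refine form_ext fun r => ?_
  simp only [ContinuousAlternatingMap.add_apply, ContinuousAlternatingMap.sub_apply]
  rw [star0_stdForm_three rfl (by decide), star0_stdForm_three rfl (by decide),
    star0_stdForm_three rfl (by decide), star0_stdForm_three rfl (by decide),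
    star0_stdForm_three rfl (by decide), star0_stdForm_three rfl (by decide),
    star0_stdForm_three rfl (by decide)]
  simp only [stdForm_stdVec_comm _ r, stdForm_stdVec r]
  simp (disch := decide) only [Matrix.cons_val, altSum_contr_zero, altSum_contr_one,
    altSum_contr_two, altSum_contr_three, altSum_contr_four]
  ring

theorem factorial_three : ((Nat.factorial 3 : ℕ) : ℝ) = 6 := by norm_num [Nat.factorial]

theorem wedge_star0_phi0_apply {l : ℕ} (β : E7 [⋀^Fin l]→L[ℝ] ℝ)
    (f' : Fin (4 + l) → Fin 7) (f : Fin (l + 1 + 1 + 1 + 1) → Fin 7)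
    (h : 4 + l = l + 1 + 1 + 1 + 1) (hf : ∀ i, f' i = f (Fin.cast h i)) :
    l.factorial * wedge (star0 (k := 3) (l := 4) rfl phi0) β (stdVec ∘ f') =
      altSum (contr 3 (contr 4 (contr 5 (contr 6 fun w => β (stdVec ∘ w))))) f
      + altSum (contr 1 (contr 2 (contr 5 (contr 6 fun w => β (stdVec ∘ w))))) f
      + altSum (contr 0 (contr 2 (contr 4 (contr 6 fun w => β (stdVec ∘ w))))) f
      + altSum (contr 0 (contr 1 (contr 4 (contr 5 fun w => β (stdVec ∘ w))))) f
      - altSum (contr 1 (contr 2 (contr 3 (contr 4 fun w => β (stdVec ∘ w))))) f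
      + altSum (contr 0 (contr 2 (contr 3 (contr 5 fun w => β (stdVec ∘ w))))) f
      - altSum (contr 0 (contr 1 (contr 3 (contr 6 fun w => β (stdVec ∘ w))))) f := by
  simp only [star0_phi0, wedge_add_left, wedge_sub_left, ContinuousAlternatingMap.add_apply,
    ContinuousAlternatingMap.sub_apply, ← wedge_stdForm_four _ _ _ _ β f' f h hf]
  ring

/-- The single coefficient of `ψ₀ ∧ T`. -/
theorem wedge_star0_phi0_eq_zero {T : E7 [⋀^Fin 3]→L[ℝ] ℝ}
    (hT : wedge (star0 (k := 3) (l := 4) rfl phi0) T = 0) :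
    T (stdVec ∘ ![0, 1, 2]) + T (stdVec ∘ ![0, 3, 4]) + T (stdVec ∘ ![1, 3, 5])
      + T (stdVec ∘ ![2, 3, 6]) - T (stdVec ∘ ![0, 5, 6]) + T (stdVec ∘ ![1, 4, 6])
      - T (stdVec ∘ ![2, 4, 5]) = 0 := by
  have h := wedge_star0_phi0_apply T ![0, 1, 2, 3, 4, 5, 6] ![0, 1, 2, 3, 4, 5, 6] rfl fun _ => rfl
  rw [hT, ContinuousAlternatingMap.coe_zero, Pi.zero_apply] at h
  simp (disch := decide) only [altSum_contr_zero, altSum_contr_one, altSum_contr_two,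
    altSum_contr_three, altSum_form_stdVec, Nat.reduceAdd, factorial_three] at h
  linarith

/-- The single coefficient of `φ₀ ∧ η`. -/
theorem wedge_phi0_four_eq_zero {η : E7 [⋀^Fin 4]→L[ℝ] ℝ} (hη : wedge phi0 η = 0) :
    η (stdVec ∘ ![3, 4, 5, 6]) + η (stdVec ∘ ![1, 2, 5, 6]) + η (stdVec ∘ ![0, 2, 4, 6])
      + η (stdVec ∘ ![0, 1, 4, 5]) - η (stdVec ∘ ![1, 2, 3, 4]) + η (stdVec ∘ ![0, 2, 3, 5])
      - η (stdVec ∘ ![0, 1, 3, 6]) = 0 := by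
  have h := wedge_phi0_apply η ![0, 1, 2, 3, 4, 5, 6] ![0, 1, 2, 3, 4, 5, 6] rfl fun _ => rfl
  rw [hη, ContinuousAlternatingMap.coe_zero, Pi.zero_apply] at h
  simp (disch := decide) only [altSum_contr_zero, altSum_contr_one, altSum_contr_two,
    altSum_contr_three, altSum_contr_four, altSum_form_stdVec, Nat.reduceAdd] at h
  rw [show ((Nat.factorial 4 : ℕ) : ℝ) = 24 by norm_num [Nat.factorial]] at h
  linarith

/-- The seven coefficients of the 6-form `φ₀ ∧ T`; the `i`-th one belongs to the product of all
basis covectors but `eⁱ`. -/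
theorem wedge_phi0_three_eq_zero {T : E7 [⋀^Fin 3]→L[ℝ] ℝ} (hT : wedge phi0 T = 0) :
    -T (stdVec ∘ ![2, 4, 6]) - T (stdVec ∘ ![1, 4, 5]) - T (stdVec ∘ ![2, 3, 5])
      + T (stdVec ∘ ![1, 3, 6]) = 0 ∧
    T (stdVec ∘ ![2, 5, 6]) - T (stdVec ∘ ![0, 4, 5]) - T (stdVec ∘ ![2, 3, 4])
      + T (stdVec ∘ ![0, 3, 6]) = 0 ∧
    T (stdVec ∘ ![1, 5, 6]) + T (stdVec ∘ ![0, 4, 6]) - T (stdVec ∘ ![1, 3, 4])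
      + T (stdVec ∘ ![0, 3, 5]) = 0 ∧
    T (stdVec ∘ ![4, 5, 6]) - T (stdVec ∘ ![1, 2, 4]) + T (stdVec ∘ ![0, 2, 5])
      - T (stdVec ∘ ![0, 1, 6]) = 0 ∧
    T (stdVec ∘ ![3, 5, 6]) - T (stdVec ∘ ![0, 2, 6]) - T (stdVec ∘ ![0, 1, 5])
      - T (stdVec ∘ ![1, 2, 3]) = 0 ∧
    T (stdVec ∘ ![3, 4, 6]) + T (stdVec ∘ ![1, 2, 6]) - T (stdVec ∘ ![0, 1, 4])
      - T (stdVec ∘ ![0, 2, 3]) = 0 ∧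
    T (stdVec ∘ ![3, 4, 5]) + T (stdVec ∘ ![1, 2, 5]) + T (stdVec ∘ ![0, 2, 4])
      - T (stdVec ∘ ![0, 1, 3]) = 0 := by
  have h0 := wedge_phi0_apply T ![1, 2, 3, 4, 5, 6] ![1, 2, 3, 4, 5, 6] rfl fun _ => rfl
  have h1 := wedge_phi0_apply T ![0, 2, 3, 4, 5, 6] ![0, 2, 3, 4, 5, 6] rfl fun _ => rfl
  have h2 := wedge_phi0_apply T ![0, 1, 3, 4, 5, 6] ![0, 1, 3, 4, 5, 6] rfl fun _ => rfl
  have h3 := wedge_phi0_apply T ![0, 1, 2, 4, 5, 6] ![0, 1, 2, 4, 5, 6] rfl fun _ => rfl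
  have h4 := wedge_phi0_apply T ![0, 1, 2, 3, 5, 6] ![0, 1, 2, 3, 5, 6] rfl fun _ => rfl
  have h5 := wedge_phi0_apply T ![0, 1, 2, 3, 4, 6] ![0, 1, 2, 3, 4, 6] rfl fun _ => rfl
  have h6 := wedge_phi0_apply T ![0, 1, 2, 3, 4, 5] ![0, 1, 2, 3, 4, 5] rfl fun _ => rfl
  rw [hT, ContinuousAlternatingMap.coe_zero, Pi.zero_apply] at h0 h1 h2 h3 h4 h5 h6
  simp (disch := decide) only [altSum_contr_zero, altSum_contr_one, altSum_contr_two,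
    altSum_contr_three, altSum_contr_four, altSum_contr_eq_zero, altSum_form_stdVec,
    Nat.reduceAdd, factorial_three] at h0 h1 h2 h3 h4 h5 h6
  refine ⟨?_, ?_, ?_, ?_, ?_, ?_, ?_⟩ <;> linarith

theorem two_form_swap {V : Type*} [AddCommGroup V] [Module ℝ V] [TopologicalSpace V]
    (F : V [⋀^Fin 2]→L[ℝ] ℝ) (x y : V) : F ![x, y] = - F ![y, x] := by
  have := map_comp_perm F ![y, x] (swap 0 1)
  rw [show ![y, x] ∘ ⇑(swap (0 : Fin 2) 1) = ![x, y] by ext1 i; fin_cases i <;> rfl] at this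
  simpa using this

theorem wedge_two_two_apply {V : Type*} [AddCommGroup V] [Module ℝ V] [TopologicalSpace V]
    (F : V [⋀^Fin 2]→L[ℝ] ℝ) (v : Fin 4 → V) :
    wedge F F v = 2 * (F ![v 0, v 1] * F ![v 2, v 3] - F ![v 0, v 2] * F ![v 1, v 3]
      + F ![v 0, v 3] * F ![v 1, v 2]) := by
  have hs := two_form_swap F
  have hm : altSum (fun w : Fin 4 → V => F (fun i => w (Fin.castAdd 2 i)) *
      F (fun j => w (Fin.natAdd 2 j))) v =
      altSum (fun w : Fin 4 → V => F ![w 0, w 1] * F ![w 2, w 3]) v := by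
    congr 1
    ext w
    congr 2 <;> ext1 i <;> fin_cases i <;> rfl
  rw [wedge_apply]
  refine (congrArg _ hm).trans ?_
  have hv : v = ![v 0, v 1, v 2, v 3] := by ext1 i; fin_cases i <;> rfl
  generalize v 0 = a at hv ⊢
  generalize v 1 = b at hv ⊢
  generalize v 2 = c at hv ⊢
  generalize v 3 = d at hv ⊢
  subst hv
  simp only [altSum_succ, Fin.sum_univ_succ, removeNth_succ_vecCons, removeNth_zero_vecCons]
  simp [altSum, Nat.factorial]
  rw [hs b a, hs c a, hs d a, hs c b, hs d b, hs d c]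
  ring

/-! ### The pointwise algebra of special instantons -/

/-- In coordinates, `|b ∧ f|² = |b|² |f|² - |ι_b f|²`. A sum over all multi-indices counts each
component of a 3-form six times and each one of a 2-form twice. -/
theorem sum_sq_cyclic {n : ℕ} {b : Fin n → ℝ} {f : Fin n → Fin n → ℝ} (hf : ∀ i j, f i j = -f j i) :
    ∑ x, ∑ y, ∑ z, (b x * f y z - b y * f x z + b z * f x y) ^ 2 =
      3 * (∑ x, b x ^ 2) * (∑ y, ∑ z, f y z ^ 2) - 6 * ∑ z, (∑ x, b x * f x z) ^ 2 := by
  have hA : ∑ x, ∑ y, ∑ z, (b x * f y z) ^ 2 = (∑ x, b x ^ 2) * (∑ y, ∑ z, f y z ^ 2) := by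
    rw [Finset.sum_mul]
    simp only [mul_pow, Finset.mul_sum]
  have hB : ∑ x, ∑ y, ∑ z, (b y * f x z) ^ 2 = (∑ x, b x ^ 2) * (∑ y, ∑ z, f y z ^ 2) := by
    rw [← hA, Finset.sum_comm]
  have hC : ∑ x, ∑ y, ∑ z, (b z * f x y) ^ 2 = (∑ x, b x ^ 2) * (∑ y, ∑ z, f y z ^ 2) := by
    rw [← hA, Finset.sum_comm_cycle]
  have hAB : ∑ x, ∑ y, ∑ z, (b x * f y z) * (b y * f x z) = ∑ z, (∑ x, b x * f x z) ^ 2 := by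
    rw [Finset.sum_comm_cycle]
    refine Finset.sum_congr rfl fun z _ => ?_
    rw [sq, Finset.sum_mul_sum]
    exact Finset.sum_congr rfl fun x _ => Finset.sum_congr rfl fun y _ => by ring
  have hAC : ∑ x, ∑ y, ∑ z, (b x * f y z) * (b z * f x y) = -∑ z, (∑ x, b x * f x z) ^ 2 := by
    rw [Finset.sum_comm, ← Finset.sum_neg_distrib]
    refine Finset.sum_congr rfl fun y _ => ?_
    rw [sq, Finset.sum_mul_sum, ← Finset.sum_neg_distrib]
    refine Finset.sum_congr rfl fun x _ => ?_
    rw [← Finset.sum_neg_distrib]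
    exact Finset.sum_congr rfl fun z _ => by rw [hf y z]; ring
  have hBC : ∑ x, ∑ y, ∑ z, (b y * f x z) * (b z * f x y) = ∑ z, (∑ x, b x * f x z) ^ 2 := by
    refine Finset.sum_congr rfl fun x _ => ?_
    rw [sq, Finset.sum_mul_sum]
    exact Finset.sum_congr rfl fun y _ => Finset.sum_congr rfl fun z _ => by
      rw [hf x z, hf x y]; ring
  have h : ∑ x, ∑ y, ∑ z, (b x * f y z - b y * f x z + b z * f x y) ^ 2 =
      ∑ x, ∑ y, ∑ z, (b x * f y z) ^ 2 + ∑ x, ∑ y, ∑ z, (b y * f x z) ^ 2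
      + ∑ x, ∑ y, ∑ z, (b z * f x y) ^ 2 - 2 * ∑ x, ∑ y, ∑ z, (b x * f y z) * (b y * f x z)
      + 2 * ∑ x, ∑ y, ∑ z, (b x * f y z) * (b z * f x y)
      - 2 * ∑ x, ∑ y, ∑ z, (b y * f x z) * (b z * f x y) := by
    simp only [Finset.mul_sum, ← Finset.sum_add_distrib, ← Finset.sum_sub_distrib]
    exact Finset.sum_congr rfl fun x _ => Finset.sum_congr rfl fun y _ =>
      Finset.sum_congr rfl fun z _ => by ring
  rw [h, hA, hB, hC, hAB, hAC, hBC]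
  ring

/-- The coordinate form of `wedge_eq_zero_of_special`: `T = b ∧ f`, the hypotheses `h0`, …, `h6` are
the coefficients of `φ₀ ∧ T`, `hQ` is that of `ψ₀ ∧ T`, `H` is `½ f ∧ f`, and `hF` is the
coefficient of `½ φ₀ ∧ f ∧ f`. -/
theorem cyclic_eq_zero {b : Fin 7 → ℝ} {f : Fin 7 → Fin 7 → ℝ} (hf : ∀ i j, f i j = -f j i)
    {T : Fin 7 → Fin 7 → Fin 7 → ℝ} {H : Fin 7 → Fin 7 → Fin 7 → Fin 7 → ℝ}
    (hT : ∀ x y z, T x y z = b x * f y z - b y * f x z + b z * f x y)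
    (hH : ∀ w x y z, H w x y z = f w x * f y z - f w y * f x z + f w z * f x y)
    (h0 : -T 2 4 6 - T 1 4 5 - T 2 3 5 + T 1 3 6 = 0)
    (h1 : T 2 5 6 - T 0 4 5 - T 2 3 4 + T 0 3 6 = 0)
    (h2 : T 1 5 6 + T 0 4 6 - T 1 3 4 + T 0 3 5 = 0)
    (h3 : T 4 5 6 - T 1 2 4 + T 0 2 5 - T 0 1 6 = 0)
    (h4 : T 3 5 6 - T 0 2 6 - T 0 1 5 - T 1 2 3 = 0)
    (h5 : T 3 4 6 + T 1 2 6 - T 0 1 4 - T 0 2 3 = 0)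
    (h6 : T 3 4 5 + T 1 2 5 + T 0 2 4 - T 0 1 3 = 0)
    (hQ : T 0 1 2 + T 0 3 4 + T 1 3 5 + T 2 3 6 - T 0 5 6 + T 1 4 6 - T 2 4 5 = 0)
    (hF : H 3 4 5 6 + H 1 2 5 6 + H 0 2 4 6 + H 0 1 4 5 - H 1 2 3 4 + H 0 2 3 5
      - H 0 1 3 6 = 0)
    (x y z : Fin 7) :
    T x y z = 0 := by
  have hd : ∀ i, f i i = 0 := fun i => by linarith [hf i i]
  have hS : ∑ x, ∑ y, ∑ z, T x y z ^ 2 = 0 := by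
    simp only [hT, hH] at *
    rw [sum_sq_cyclic hf]
    simp only [Fin.sum_univ_seven, hd, hf 1 0, hf 2 0, hf 3 0, hf 4 0, hf 5 0, hf 6 0, hf 2 1,
      hf 3 1, hf 4 1, hf 5 1, hf 6 1, hf 3 2, hf 4 2, hf 5 2, hf 6 2, hf 4 3, hf 5 3, hf 6 3,
      hf 5 4, hf 6 4, hf 6 5]
    generalize b 0 = b0 at *
    generalize b 1 = b1 at *
    generalize b 2 = b2 at *
    generalize b 3 = b3 at *
    generalize b 4 = b4 at *
    generalize b 5 = b5 at *
    generalize b 6 = b6 at *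
    generalize f 0 1 = f01 at *
    generalize f 0 2 = f02 at *
    generalize f 0 3 = f03 at *
    generalize f 0 4 = f04 at *
    generalize f 0 5 = f05 at *
    generalize f 0 6 = f06 at *
    generalize f 1 2 = f12 at *
    generalize f 1 3 = f13 at *
    generalize f 1 4 = f14 at *
    generalize f 1 5 = f15 at *
    generalize f 1 6 = f16 at *
    generalize f 2 3 = f23 at *
    generalize f 2 4 = f24 at *
    generalize f 2 5 = f25 at *
    generalize f 2 6 = f26 at *
    generalize f 3 4 = f34 at *
    generalize f 3 5 = f35 at *
    generalize f 3 6 = f36 at *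
    generalize f 4 5 = f45 at *
    generalize f 4 6 = f46 at *
    generalize f 5 6 = f56 at *
    -- The identity `|T|² = |b|² *(φ₀ ∧ f ∧ f) + (*(ψ₀ ∧ T))² + |φ₀ ∧ T|² - 2 ⟨ι_b f, *(φ₀ ∧ T)⟩`
    -- for `T = b ∧ f`, multiplied by 6.
    linear_combination
      12 * (b0 ^ 2 + b1 ^ 2 + b2 ^ 2 + b3 ^ 2 + b4 ^ 2 + b5 ^ 2 + b6 ^ 2) * hF
      + 6 * ((b0 * f12 - b1 * f02 + b2 * f01) + (b0 * f34 - b3 * f04 + b4 * f03)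
          + (b1 * f35 - b3 * f15 + b5 * f13) + (b2 * f36 - b3 * f26 + b6 * f23)
          - (b0 * f56 - b5 * f06 + b6 * f05) + (b1 * f46 - b4 * f16 + b6 * f14)
          - (b2 * f45 - b4 * f25 + b5 * f24)) * hQ
      + (6 * (-(b2 * f46 - b4 * f26 + b6 * f24) - (b1 * f45 - b4 * f15 + b5 * f14)
          - (b2 * f35 - b3 * f25 + b5 * f23) + (b1 * f36 - b3 * f16 + b6 * f13))
        - 12 * (-b1 * f01 - b2 * f02 - b3 * f03 - b4 * f04 - b5 * f05 - b6 * f06)) * h0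
      + (6 * ((b2 * f56 - b5 * f26 + b6 * f25) - (b0 * f45 - b4 * f05 + b5 * f04)
          - (b2 * f34 - b3 * f24 + b4 * f23) + (b0 * f36 - b3 * f06 + b6 * f03))
        + 12 * (b0 * f01 - b2 * f12 - b3 * f13 - b4 * f14 - b5 * f15 - b6 * f16)) * h1
      + (6 * ((b1 * f56 - b5 * f16 + b6 * f15) + (b0 * f46 - b4 * f06 + b6 * f04)
          - (b1 * f34 - b3 * f14 + b4 * f13) + (b0 * f35 - b3 * f05 + b5 * f03))
        - 12 * (b0 * f02 + b1 * f12 - b3 * f23 - b4 * f24 - b5 * f25 - b6 * f26)) * h2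
      + (6 * ((b4 * f56 - b5 * f46 + b6 * f45) - (b1 * f24 - b2 * f14 + b4 * f12)
          + (b0 * f25 - b2 * f05 + b5 * f02) - (b0 * f16 - b1 * f06 + b6 * f01))
        + 12 * (b0 * f03 + b1 * f13 + b2 * f23 - b4 * f34 - b5 * f35 - b6 * f36)) * h3
      + (6 * ((b3 * f56 - b5 * f36 + b6 * f35) - (b0 * f26 - b2 * f06 + b6 * f02)
          - (b0 * f15 - b1 * f05 + b5 * f01) - (b1 * f23 - b2 * f13 + b3 * f12))
        - 12 * (b0 * f04 + b1 * f14 + b2 * f24 + b3 * f34 - b5 * f45 - b6 * f46)) * h4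
      + (6 * ((b3 * f46 - b4 * f36 + b6 * f34) + (b1 * f26 - b2 * f16 + b6 * f12)
          - (b0 * f14 - b1 * f04 + b4 * f01) - (b0 * f23 - b2 * f03 + b3 * f02))
        + 12 * (b0 * f05 + b1 * f15 + b2 * f25 + b3 * f35 + b4 * f45 - b6 * f56)) * h5
      + (6 * ((b3 * f45 - b4 * f35 + b5 * f34) + (b1 * f25 - b2 * f15 + b5 * f12)
          + (b0 * f24 - b2 * f04 + b4 * f02) - (b0 * f13 - b1 * f03 + b3 * f01))
        - 12 * (b0 * f06 + b1 * f16 + b2 * f26 + b3 * f36 + b4 * f46 + b5 * f56)) * h6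
  have h1 := (Finset.sum_eq_zero_iff_of_nonneg fun _ _ => Finset.sum_nonneg fun _ _ =>
    Finset.sum_nonneg fun _ _ => sq_nonneg _).1 hS x (Finset.mem_univ x)
  have h2 := (Finset.sum_eq_zero_iff_of_nonneg fun _ _ => Finset.sum_nonneg fun _ _ =>
    sq_nonneg _).1 h1 y (Finset.mem_univ y)
  exact pow_eq_zero_iff two_ne_zero |>.1
    ((Finset.sum_eq_zero_iff_of_nonneg fun _ _ => sq_nonneg _).1 h2 z (Finset.mem_univ z))

theorem wedge_one_two_apply {V : Type*} [AddCommGroup V] [Module ℝ V] [TopologicalSpace V]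
    (β : V [⋀^Fin 1]→L[ℝ] ℝ) (F : V [⋀^Fin 2]→L[ℝ] ℝ) (x y z : V) :
    wedge β F ![x, y, z] = β (fun _ => x) * F ![y, z] - β (fun _ => y) * F ![x, z]
      + β (fun _ => z) * F ![x, y] := by
  rw [wedge_one_apply β F ![x, y, z] ![x, y, z] fun _ => rfl]
  simp only [Fin.sum_univ_succ, removeNth_succ_vecCons, removeNth_zero_vecCons]
  simp
  ring

theorem stdVec_comp_three (x y z : Fin 7) :
    stdVec ∘ ![x, y, z] = ![stdVec x, stdVec y, stdVec z] := by
  ext1 i; fin_cases i <;> rfl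

/-- The pointwise heart of the argument: `φ₀ ∧ β ∧ F = 0`, `ψ₀ ∧ β ∧ F = 0` and `φ₀ ∧ F ∧ F = 0`
force `β ∧ F = 0`. -/
theorem wedge_eq_zero_of_special {β : E7 [⋀^Fin 1]→L[ℝ] ℝ} {F : E7 [⋀^Fin 2]→L[ℝ] ℝ}
    (h1 : wedge phi0 (wedge β F) = 0)
    (h2 : wedge (star0 (k := 3) (l := 4) rfl phi0) (wedge β F) = 0)
    (h3 : wedge phi0 (wedge F F) = 0) : wedge β F = 0 := by
  obtain ⟨e0, e1, e2, e3, e4, e5, e6⟩ := wedge_phi0_three_eq_zero h1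
  have hQ := wedge_star0_phi0_eq_zero h2
  have hF := wedge_phi0_four_eq_zero h3
  have key := cyclic_eq_zero (b := fun x => β (fun _ => stdVec x))
    (f := fun x y => F ![stdVec x, stdVec y])
    (T := fun x y z => wedge β F (stdVec ∘ ![x, y, z]))
    (H := fun w x y z => wedge F F (stdVec ∘ ![w, x, y, z]) / 2)
    (fun x y => two_form_swap F _ _)
    (fun x y z => (congrArg (wedge β F) (stdVec_comp_three x y z)).trans
      (wedge_one_two_apply β F _ _ _))
    (fun w x y z => by
      have h := wedge_two_two_apply F (stdVec ∘ ![w, x, y, z])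
      change _ = 2 * (F ![stdVec w, stdVec x] * F ![stdVec y, stdVec z]
        - F ![stdVec w, stdVec y] * F ![stdVec x, stdVec z]
        + F ![stdVec w, stdVec z] * F ![stdVec x, stdVec y]) at h
      linarith)
    e0 e1 e2 e3 e4 e5 e6 hQ (by linarith [hF])
  refine form_ext fun g => ?_
  have hg : g = ![g 0, g 1, g 2] := by ext1 i; fin_cases i <;> rfl
  rw [hg]
  exact key _ _ _

theorem sum_mul_eq_zero_of_wedge_star0 {β : E7 [⋀^Fin 1]→L[ℝ] ℝ} {F : E7 [⋀^Fin 2]→L[ℝ] ℝ}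
    (h : wedge β (star0 (k := 2) (l := 5) rfl F) = 0) (i : Fin 7) :
    ∑ j, β (fun _ => stdVec j) * F ![stdVec i, stdVec j] = 0 := by
  have hi := wedge_star0_succAbove β F i
  -- The degrees `1 + 5` and `6` agree only after unfolding, which makes rewriting with `h` costly.
  generalize wedge β (star0 (k := 2) (l := 5) rfl F) = γ at h hi
  subst h
  rw [ContinuousAlternatingMap.coe_zero, Pi.zero_apply] at hi
  exact (mul_eq_zero.1 hi.symm).resolve_left (by simp)

/-- If `β ≠ 0`, then `β ∧ F = 0` makes `F` divisible by `β`, while `β ∧ *F = 0` says that the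
contraction of `F` with `β` is zero; so `β = 0` or `F = 0`. -/
theorem tensor_eq_zero {β : E7 [⋀^Fin 1]→L[ℝ] ℝ} {F : E7 [⋀^Fin 2]→L[ℝ] ℝ}
    (h1 : wedge β F = 0) (h2 : wedge β (star0 (k := 2) (l := 5) rfl F) = 0) (u : E7) :
    β (fun _ => u) • F = 0 := by
  have hb := sum_mul_eq_zero_of_wedge_star0 h2
  by_cases hβ : β = 0
  · simp [hβ]
  obtain ⟨i, hi⟩ : ∃ i, β (fun _ => stdVec i) ≠ 0 := by
    by_contra! hc
    exact hβ (form_ext fun g => by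
      have hg : stdVec ∘ g = fun _ => stdVec (g 0) := by ext1 j; fin_cases j; rfl
      rw [hg]; exact hc _)
  have hF : F = 0 := by
    refine form_ext fun g => ?_
    have hg : stdVec ∘ g = ![stdVec (g 0), stdVec (g 1)] := by ext1 j; fin_cases j <;> rfl
    rw [hg]
    have hpos : 0 < ∑ j, β (fun _ => stdVec j) ^ 2 :=
      Finset.sum_pos' (fun _ _ => sq_nonneg _) ⟨i, Finset.mem_univ i, by positivity⟩
    have h3 : ∀ j, β (fun _ => stdVec j) * F ![stdVec (g 0), stdVec (g 1)]
        = β (fun _ => stdVec (g 0)) * F ![stdVec j, stdVec (g 1)]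
          - β (fun _ => stdVec (g 1)) * F ![stdVec j, stdVec (g 0)] := by
      intro j
      have h := wedge_one_two_apply β F (stdVec j) (stdVec (g 0)) (stdVec (g 1))
      rw [h1] at h
      have h' : (0 : E7 [⋀^Fin 3]→L[ℝ] ℝ) ![stdVec j, stdVec (g 0), stdVec (g 1)] = 0 := rfl
      have h'' := h'.symm.trans h
      linarith
    have h4 : (∑ j, β (fun _ => stdVec j) ^ 2) * F ![stdVec (g 0), stdVec (g 1)] = 0 := by
      have h5 : ∀ j, β (fun _ => stdVec j) ^ 2 * F ![stdVec (g 0), stdVec (g 1)] =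
          -β (fun _ => stdVec (g 0)) * (β (fun _ => stdVec j) * F ![stdVec (g 1), stdVec j])
          + β (fun _ => stdVec (g 1)) * (β (fun _ => stdVec j) * F ![stdVec (g 0), stdVec j]) := by
        intro j
        rw [two_form_swap F (stdVec (g 1)), two_form_swap F (stdVec (g 0)) (stdVec j)]
        linear_combination β (fun _ => stdVec j) * h3 j
      rw [Finset.sum_mul, Finset.sum_congr rfl fun j _ => h5 j, Finset.sum_add_distrib,
        ← Finset.mul_sum, ← Finset.mul_sum, hb, hb]
      simp
    exact (mul_eq_zero.1 h4).resolve_left hpos.ne'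
  simp [hF]

/-! ### The exterior derivative and the Leibniz rule -/

section
variable {ι : Type*}

/-- Alternating already over all arguments but the first contributes the factor `n!`. -/
theorem altSum_collapse_tail {n : ℕ} (h : ι → (Fin n → ι) → ℝ) (v : Fin (n + 1) → ι) :
    altSum (fun w => altSum (h (w 0)) (Fin.tail w)) v =
      n.factorial * altSum (fun w => h (w 0) (Fin.tail w)) v := by
  rw [altSum_succ, altSum_succ, Finset.mul_sum]
  refine Finset.sum_congr rfl fun p _ => ?_
  simp only [Fin.cons_zero, Fin.tail_cons]
  rw [altSum_of_alternating _ fun σ => altSum_perm _ σ _]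
  ring

theorem altSum_add {n : ℕ} (m m' : (Fin n → ι) → ℝ) (v : Fin n → ι) :
    altSum (fun w => m w + m' w) v = altSum m v + altSum m' v := by
  simp only [altSum, mul_add, Finset.sum_add_distrib]

end

section
variable {E : Type*} [NormedAddCommGroup E] [NormedSpace ℝ E]

theorem extDeriv_eq_altSum {n : ℕ} (η : E → E [⋀^Fin n]→L[ℝ] ℝ) (x : E) (v : Fin (n + 1) → E) :
    extDeriv η x v = (n.factorial : ℝ)⁻¹ *
      altSum (fun w => fderiv ℝ η x (w 0) (Fin.tail w)) v := by
  have h0 := Nat.cast_ne_zero (R := ℝ).2 n.factorial_ne_zero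
  have h : altSum (fun w => fderiv ℝ η x (w 0) (Fin.tail w)) v = n.factorial * extDeriv η x v := by
    rw [altSum_succ, extDeriv, ContinuousAlternatingMap.alternatizeUncurryFin_apply,
      Finset.mul_sum]
    refine Finset.sum_congr rfl fun p _ => ?_
    simp only [Fin.cons_zero, Fin.tail_cons]
    rw [altSum_apply_form]
    simp
    ring
  rw [h]
  field_simp

theorem isBoundedBilinearMap_wedge (k l : ℕ) :
    IsBoundedBilinearMap ℝ (fun p : (E [⋀^Fin k]→L[ℝ] ℝ) × (E [⋀^Fin l]→L[ℝ] ℝ) =>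
      wedge p.1 p.2) where
  add_left := wedge_add_left
  smul_left c α β := by
    ext v
    simp [wedge_apply, altSum, Finset.mul_sum, mul_assoc, mul_left_comm]
  add_right α β β' := by
    ext v
    simp [wedge_apply, altSum, mul_add, Finset.sum_add_distrib]
  smul_right c α β := by
    ext v
    simp [wedge_apply, altSum, Finset.mul_sum, mul_left_comm]
  bound := by
    refine ⟨(k + l).factorial, by positivity, fun α β => ?_⟩
    refine ContinuousAlternatingMap.opNorm_le_bound (f := wedge α β)
      (M := (k + l).factorial * ‖α‖ * ‖β‖) (by positivity) fun v => ?_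
    have hterm : ∀ σ : Perm (Fin (k + l)),
        ‖((Perm.sign σ : ℤ) : ℝ) * (α (fun i => (v ∘ σ) (Fin.castAdd l i)) *
          β (fun j => (v ∘ σ) (Fin.natAdd k j)))‖ ≤ ‖α‖ * ‖β‖ * ∏ i, ‖v i‖ := by
      intro σ
      have h1 : ‖((Perm.sign σ : ℤ) : ℝ)‖ = 1 := by
        rcases Int.units_eq_one_or (Perm.sign σ) with h | h <;> simp [h]
      have h2 : ∏ i, ‖v i‖ = (∏ i, ‖(v ∘ σ) (Fin.castAdd l i)‖) *
          ∏ j, ‖(v ∘ σ) (Fin.natAdd k j)‖ := by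
        rw [← Fin.prod_univ_add (fun i => ‖(v ∘ σ) i‖)]
        exact (Equiv.prod_comp σ fun i => ‖v i‖).symm
      rw [norm_mul, norm_mul, h1, one_mul, h2]
      calc _ ≤ (‖α‖ * ∏ i, ‖(v ∘ σ) (Fin.castAdd l i)‖) *
          (‖β‖ * ∏ j, ‖(v ∘ σ) (Fin.natAdd k j)‖) :=
            mul_le_mul (α.le_opNorm _) (β.le_opNorm _) (norm_nonneg _) (by positivity)
        _ = _ := by ring
    rw [wedge_apply, norm_mul]
    have h3 : ‖((k.factorial : ℝ) * l.factorial)⁻¹‖ ≤ 1 := by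
      rw [norm_inv]
      refine inv_le_one_of_one_le₀ ?_
      rw [Real.norm_of_nonneg (by positivity)]
      exact_mod_cast Nat.one_le_iff_ne_zero.2
        (mul_ne_zero k.factorial_ne_zero l.factorial_ne_zero)
    calc _ ≤ 1 * ∑ σ : Perm (Fin (k + l)), ‖α‖ * ‖β‖ * ∏ i, ‖v i‖ :=
          mul_le_mul h3 (norm_sum_le_of_le _ fun σ _ => hterm σ) (norm_nonneg _) zero_le_one
      _ = _ := by
          simp [Fintype.card_perm]
          ring

/-- The Leibniz rule `d(α ∧ β) = dα ∧ β + (-1)^k α ∧ dβ`. The casts reconcile the degrees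
`k + l + 1`, `k + 1 + l` and `k + (l + 1)`. -/
theorem extDeriv_wedge {k l : ℕ} {α : E → E [⋀^Fin k]→L[ℝ] ℝ} {β : E → E [⋀^Fin l]→L[ℝ] ℝ}
    {x : E} (hα : DifferentiableAt ℝ α x) (hβ : DifferentiableAt ℝ β x)
    (v : Fin (k + l + 1) → E) :
    extDeriv (fun y => wedge (α y) (β y)) x v =
      wedge (extDeriv α x) (β x) (v ∘ Fin.cast (Nat.add_right_comm k 1 l)) +
        (-1) ^ k * wedge (α x) (extDeriv β x) (v ∘ Fin.cast (Nat.add_assoc k l 1).symm) := by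
  have hk := Nat.cast_ne_zero (R := ℝ).2 k.factorial_ne_zero
  have hl := Nat.cast_ne_zero (R := ℝ).2 l.factorial_ne_zero
  have hkl := Nat.cast_ne_zero (R := ℝ).2 (k + l).factorial_ne_zero
  have hD : fderiv ℝ (fun y => wedge (α y) (β y)) x = fun u =>
      wedge (α x) (fderiv ℝ β x u) + wedge (fderiv ℝ α x u) (β x) := by
    have h := ((isBoundedBilinearMap_wedge (E := E) k l).hasFDerivAt (α x, β x)).comp x
      (hα.hasFDerivAt.prodMk hβ.hasFDerivAt)
    ext1 u
    exact congrArg (fun L => L u) h.fderiv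
  have h1 : wedge (extDeriv α x) (β x) (v ∘ Fin.cast (Nat.add_right_comm k 1 l)) =
      ((k.factorial : ℝ) * l.factorial)⁻¹ * altSum (fun w : Fin (k + l + 1) → E =>
        fderiv ℝ α x (w 0) (fun i => Fin.tail w (Fin.castAdd l i)) *
          β x (fun j => Fin.tail w (Fin.natAdd k j))) v := by
    have hm : ∀ w : Fin (k + 1 + l) → E,
        extDeriv α x (fun i => w (Fin.castAdd l i)) * β x (fun j => w (Fin.natAdd (k + 1) j)) =
        (k.factorial : ℝ)⁻¹ * (altSum (fun u => fderiv ℝ α x (u 0) (Fin.tail u))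
          (fun i => w (Fin.castAdd l i)) * β x (fun j => w (Fin.natAdd (k + 1) j))) := by
      intro w
      rw [extDeriv_eq_altSum, mul_assoc]
    have hw : ∀ w : Fin (k + l + 1) → E,
        fderiv ℝ α x ((w ∘ Fin.cast (Nat.add_right_comm k 1 l)) (Fin.castAdd l 0))
          (Fin.tail fun i => (w ∘ Fin.cast (Nat.add_right_comm k 1 l)) (Fin.castAdd l i)) *
        β x (fun j => (w ∘ Fin.cast (Nat.add_right_comm k 1 l)) (Fin.natAdd (k + 1) j)) =
        fderiv ℝ α x (w 0) (fun i => Fin.tail w (Fin.castAdd l i)) *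
          β x (fun j => Fin.tail w (Fin.natAdd k j)) := by
      intro w
      congr 2
      ext1 j
      simp only [Function.comp_apply, Fin.tail]
      congr 1
      ext
      simp only [Fin.val_cast, Fin.val_natAdd, Fin.val_succ]
      omega
    rw [wedge_apply]
    simp only [hm]
    rw [altSum_const_mul, altSum_collapse_left (fun u => fderiv ℝ α x (u 0) (Fin.tail u))
      (fun u => β x u), altSum_comp_cast]
    simp only [hw]
    have := Nat.cast_ne_zero (R := ℝ).2 (k + 1).factorial_ne_zero
    field_simp
  have h2 : wedge (α x) (extDeriv β x) (v ∘ Fin.cast (Nat.add_assoc k l 1).symm) =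
      ((k.factorial : ℝ) * l.factorial)⁻¹ * ((-1) ^ k * altSum (fun w : Fin (k + l + 1) → E =>
        α x (fun i => Fin.tail w (Fin.castAdd l i)) *
          fderiv ℝ β x (w 0) (fun j => Fin.tail w (Fin.natAdd k j))) v) := by
    have hm : ∀ w : Fin (k + (l + 1)) → E,
        α x (fun i => w (Fin.castAdd (l + 1) i)) * extDeriv β x (fun j => w (Fin.natAdd k j)) =
        (l.factorial : ℝ)⁻¹ * (α x (fun i => w (Fin.castAdd (l + 1) i)) *
          altSum (fun u => fderiv ℝ β x (u 0) (Fin.tail u)) (fun j => w (Fin.natAdd k j))) := by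
      intro w
      rw [extDeriv_eq_altSum]
      ring
    -- The derivative of `β` takes its direction in position `k`; moving it to position `0` is a
    -- cycle of sign `(-1) ^ k`.
    let p : Fin (k + l + 1) := ⟨k, by omega⟩
    let m : (Fin (k + l + 1) → E) → ℝ := fun w =>
      α x (fun i => (w ∘ Fin.cast (Nat.add_assoc k l 1).symm) (Fin.castAdd (l + 1) i)) *
      fderiv ℝ β x ((w ∘ Fin.cast (Nat.add_assoc k l 1).symm) (Fin.natAdd k 0))
      (Fin.tail fun j => (w ∘ Fin.cast (Nat.add_assoc k l 1).symm) (Fin.natAdd k j))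
    have hw : ∀ w : Fin (k + l + 1) → E,
        α x (fun i => Fin.tail w (Fin.castAdd l i)) *
          fderiv ℝ β x (w 0) (fun j => Fin.tail w (Fin.natAdd k j)) =
        m (w ∘ Fin.cycleRange p) := by
      intro w
      have e1 : ∀ i : Fin k, Fin.cycleRange p (Fin.cast (Nat.add_assoc k l 1).symm
          (Fin.castAdd (l + 1) i)) = (Fin.castAdd l i).succ := by
        intro i
        rw [Fin.cycleRange_of_lt (by simp [p, Fin.lt_def])]
        ext
        rw [Fin.val_add_one_of_lt (by
          simp only [Fin.lt_def, Fin.val_cast, Fin.val_castAdd, Fin.val_last]; omega)]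
        simp
      have e2 : Fin.cycleRange p (Fin.cast (Nat.add_assoc k l 1).symm (Fin.natAdd k 0)) = 0 :=
        Fin.cycleRange_of_eq (by ext; simp [p])
      have e3 : ∀ j : Fin l, Fin.cycleRange p (Fin.cast (Nat.add_assoc k l 1).symm
          (Fin.natAdd k j.succ)) = (Fin.natAdd k j).succ := by
        intro j
        rw [Fin.cycleRange_of_gt (by simp [p, Fin.lt_def])]
        ext
        simp only [Fin.val_cast, Fin.val_natAdd, Fin.val_succ]
        omega
      simp only [m, Function.comp_apply, e1, e2]
      congr 2
      ext1 j
      exact congrArg w (e3 j).symm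
    have hsign : altSum (fun w => α x (fun i => Fin.tail w (Fin.castAdd l i)) *
          fderiv ℝ β x (w 0) (fun j => Fin.tail w (Fin.natAdd k j))) v =
        (-1) ^ k * altSum m v := by
      rw [funext hw, altSum_comp_perm m (Fin.cycleRange p) v, Fin.sign_cycleRange]
      push_cast
      rfl
    rw [wedge_apply]
    simp only [hm]
    rw [altSum_const_mul, altSum_collapse_right (fun u => α x u)
      (fun u => fderiv ℝ β x (u 0) (Fin.tail u)), altSum_comp_cast]
    have := Nat.cast_ne_zero (R := ℝ).2 (l + 1).factorial_ne_zero
    have h3 : ((-1 : ℝ) ^ k) * (-1) ^ k = 1 := by rw [← mul_pow]; simp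
    rw [hsign, ← mul_assoc ((-1 : ℝ) ^ k), h3, one_mul]
    change _ = _ * altSum (fun w => m w) v
    simp only [m]
    field_simp
  have h3 : ((-1 : ℝ) ^ k) * (-1) ^ k = 1 := by rw [← mul_pow]; simp
  rw [extDeriv_eq_altSum, hD, h1, h2]
  simp only [ContinuousAlternatingMap.add_apply, wedge_apply, altSum_add, altSum_const_mul]
  rw [altSum_collapse_tail (fun u w => α x (fun i => w (Fin.castAdd l i)) *
      fderiv ℝ β x u (fun j => w (Fin.natAdd k j))),
    altSum_collapse_tail (fun u w => fderiv ℝ α x u (fun i => w (Fin.castAdd l i)) *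
      β x (fun j => w (Fin.natAdd k j)))]
  field_simp
  linear_combination (-1) * (altSum (fun w : Fin (k + l + 1) → E =>
        α x (fun i => Fin.tail w (Fin.castAdd l i)) *
          fderiv ℝ β x (w 0) (fun j => Fin.tail w (Fin.natAdd k j))) v) * h3

end

section
variable {E : Type*} [NormedAddCommGroup E] [NormedSpace ℝ E]

theorem differentiableAt_wedge {k l : ℕ} {α : E → E [⋀^Fin k]→L[ℝ] ℝ}
    {β : E → E [⋀^Fin l]→L[ℝ] ℝ} {x : E} (hα : DifferentiableAt ℝ α x)
    (hβ : DifferentiableAt ℝ β x) : DifferentiableAt ℝ (fun y => wedge (α y) (β y)) x :=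
  DifferentiableAt.comp (g := fun p => wedge p.1 p.2) (f := fun y => (α y, β y)) x
    ((isBoundedBilinearMap_wedge (E := E) k l).differentiableAt (α x, β x)) (hα.prodMk hβ)

theorem extDeriv_eq_zero_of_eventually {n : ℕ} {η : E → E [⋀^Fin n]→L[ℝ] ℝ} {x : E}
    (h : ∀ᶠ y in 𝓝 x, η y = 0) : extDeriv η x = 0 := by
  have h1 : η =ᶠ[𝓝 x] fun _ => 0 := h
  rw [h1.extDeriv_eq]
  simp only [extDeriv, fderiv_fun_const, Pi.zero_apply]
  exact map_zero (ContinuousAlternatingMap.alternatizeUncurryFinCLM ℝ E ℝ)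

theorem wedge_extDeriv_eq_zero {k l : ℕ} {α : E → E [⋀^Fin k]→L[ℝ] ℝ}
    {β : E → E [⋀^Fin l]→L[ℝ] ℝ} {x : E} (hα : DifferentiableAt ℝ α x)
    (hβ : DifferentiableAt ℝ β x) (hd : extDeriv α x = 0)
    (h : ∀ᶠ y in 𝓝 x, wedge (α y) (β y) = 0) : wedge (α x) (extDeriv β x) = 0 := by
  ext v
  have h1 := extDeriv_wedge hα hβ (v ∘ Fin.cast (Nat.add_assoc k l 1))
  rw [extDeriv_eq_zero_of_eventually h, hd, wedge_zero_left] at h1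
  have h2 : ((v ∘ Fin.cast (Nat.add_assoc k l 1)) ∘ Fin.cast (Nat.add_assoc k l 1).symm) = v := rfl
  rw [h2] at h1
  simpa using h1

theorem differentiableAt_extDeriv {n : ℕ} {η : E → E [⋀^Fin n]→L[ℝ] ℝ} {x : E}
    (h : ContDiffAt ℝ ∞ η x) : DifferentiableAt ℝ (extDeriv η) x := by
  have : DifferentiableAt ℝ (fderiv ℝ η) x :=
    (h.fderiv_right (m := 1) (by norm_cast)).differentiableAt (by simp)
  exact (ContinuousAlternatingMap.alternatizeUncurryFinCLM ℝ E ℝ).differentiableAt.comp x this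

/-- `d(b ∧ db) = db ∧ db` for a 1-form `b`. -/
theorem extDeriv_wedge_extDeriv {b : E → E [⋀^Fin 1]→L[ℝ] ℝ} {x : E}
    (hb : ContDiffAt ℝ ∞ b x) (v : Fin 4 → E) :
    extDeriv (fun y => wedge (b y) (extDeriv b y)) x v =
      wedge (extDeriv b x) (extDeriv b x) v := by
  have h1 : DifferentiableAt ℝ b x := hb.differentiableAt (by simp)
  have h2 := differentiableAt_extDeriv hb
  have h3 : extDeriv (extDeriv b) x = 0 :=
    extDeriv_extDeriv_apply hb (by simpa using ENat.LEInfty.out)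
  have h4 := extDeriv_wedge h1 h2 v
  rw [h3, wedge_zero_right] at h4
  exact h4.trans (by simp)

theorem wedge_extDeriv_sq_eq_zero {b : E → E [⋀^Fin 1]→L[ℝ] ℝ} {x : E}
    (hb : ContDiffAt ℝ ∞ b x) (h : ∀ᶠ y in 𝓝 x, wedge (b y) (extDeriv b y) = 0) :
    wedge (extDeriv b x) (extDeriv b x) = 0 := by
  ext v
  rw [← extDeriv_wedge_extDeriv hb v, extDeriv_eq_zero_of_eventually h]

theorem wedge_wedge_extDeriv_sq_eq_zero {k : ℕ} {φ : E → E [⋀^Fin k]→L[ℝ] ℝ}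
    {b : E → E [⋀^Fin 1]→L[ℝ] ℝ} {x : E} (hφ : DifferentiableAt ℝ φ x)
    (hdφ : extDeriv φ x = 0) (hb : ContDiffAt ℝ ∞ b x)
    (h : ∀ᶠ y in 𝓝 x, wedge (φ y) (wedge (b y) (extDeriv b y)) = 0) :
    wedge (φ x) (wedge (extDeriv b x) (extDeriv b x)) = 0 := by
  have h1 := wedge_extDeriv_eq_zero hφ (differentiableAt_wedge
    (hb.differentiableAt (by simp)) (differentiableAt_extDeriv hb)) hdφ h
  have h2 : extDeriv (fun y => wedge (b y) (extDeriv b y)) x =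
      wedge (extDeriv b x) (extDeriv b x) := by
    ext v
    exact extDeriv_wedge_extDeriv hb v
  exact (congrArg (wedge (φ x)) h2).symm.trans h1

/-- If `b = 0` or `db = 0` at each point near `x`, then `db = 0` at `x`: where `db ≠ 0`, which is an
open condition, `b` vanishes identically, and hence so does `db`. -/
theorem extDeriv_eq_zero_of_smul_eq_zero {b : E → E [⋀^Fin 1]→L[ℝ] ℝ} {x : E}
    (hb : ContDiffAt ℝ ∞ b x)
    (h : ∀ᶠ y in 𝓝 x, ∀ u : E, b y (fun _ => u) • extDeriv b y = 0) : extDeriv b x = 0 := by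
  by_contra hne
  refine hne (extDeriv_eq_zero_of_eventually ?_)
  filter_upwards [h, (differentiableAt_extDeriv hb).continuousAt.eventually_ne hne] with y hy hy'
  ext v
  have hv : v = fun _ => v 0 := by
    ext1 i
    rw [Subsingleton.elim i 0]
  rw [hv]
  exact (smul_eq_zero.1 (hy (v 0))).resolve_right hy'

end

/-! ### A torsion-free `G₂`-structure is closed -/

section
variable {M : Type*} [TopologicalSpace M] [ChartedSpace E7 M]

theorem GTwoStructure.metricInChart_comm (G : GTwoStructure M) (x₀ : M) (y : E7) (i j : Fin 7) :
    G.metricInChart x₀ y i j = G.metricInChart x₀ y j i :=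
  real_inner_comm _ _

theorem GTwoStructure.christoffel_comm (G : GTwoStructure M) (x₀ : M) (y : E7) (m i j : Fin 7) :
    G.christoffel x₀ y m i j = G.christoffel x₀ y m j i := by
  unfold GTwoStructure.christoffel
  simp only [G.metricInChart_comm x₀ _ i j]
  congr 1
  refine Finset.sum_congr rfl fun l _ => ?_
  ring

/-- The Christoffel terms of `∇η` cancel when `∇η` is antisymmetrized to `dη`, because `Γ` is
symmetric in its lower indices. The upper index `m` is fixed here. -/
theorem sum_symm_mul_update_eq_zero {ι V : Type*} [AddCommGroup V] [Module ℝ V]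
    [TopologicalSpace V] (e : ι → V) (η : V [⋀^Fin 3]→L[ℝ] ℝ)
    (Γ : ι → ι → ℝ) (hΓ : ∀ i j, Γ i j = Γ j i) (f : Fin 4 → ι) (m : ι) :
    ∑ i : Fin 4, (-1 : ℝ) ^ (i : ℕ) * ∑ s : Fin 3, Γ (f i) (i.removeNth f s) *
      η (fun a => e (Function.update (i.removeNth f) s m a)) = 0 := by
  have h1 : ∀ p q r : ι, η ![e p, e q, e r] = -η ![e q, e p, e r] := by
    intro p q r
    refine (congrArg η ?_).trans
      (η.toAlternatingMap.map_swap ![e q, e p, e r] (show (0 : Fin 3) ≠ 1 by decide))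
    ext i
    fin_cases i <;> rfl
  have h2 : ∀ p q r : ι, η ![e p, e q, e r] = -η ![e p, e r, e q] := by
    intro p q r
    refine (congrArg η ?_).trans
      (η.toAlternatingMap.map_swap ![e p, e r, e q] (show (1 : Fin 3) ≠ 2 by decide))
    ext i
    fin_cases i <;> rfl
  have hv : ∀ v : Fin 3 → ι, η (fun a => e (v a)) = η ![e (v 0), e (v 1), e (v 2)] := by
    intro v
    congr 1
    ext i
    fin_cases i <;> rfl
  have r0 : Fin.removeNth 0 f = ![f 1, f 2, f 3] := by ext i; fin_cases i <;> rfl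
  have r1 : Fin.removeNth 1 f = ![f 0, f 2, f 3] := by ext i; fin_cases i <;> rfl
  have r2 : Fin.removeNth 2 f = ![f 0, f 1, f 3] := by ext i; fin_cases i <;> rfl
  have r3 : Fin.removeNth 3 f = ![f 0, f 1, f 2] := by ext i; fin_cases i <;> rfl
  simp only [hv, Fin.sum_univ_four, Fin.sum_univ_three, r0, r1, r2, r3]
  simp only [Function.update_apply, Matrix.cons_val, Fin.isValue, Fin.reduceEq, if_true, if_false,
    Fin.val_zero, Fin.val_one, Fin.val_two]
  rw [h2 (f 1) (f 2) m, h2 (f 0) (f 2) m, h2 (f 0) (f 1) m, h1 (f 1) m (f 3), h1 (f 1) m (f 2),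
    h1 (f 0) m (f 3), h1 (f 0) m (f 2), h1 (f 0) m (f 1), hΓ (f 1) (f 0), hΓ (f 2) (f 0),
    hΓ (f 3) (f 0), hΓ (f 2) (f 1), hΓ (f 3) (f 1), hΓ (f 3) (f 2)]
  simp
  ring

theorem DiffForm.IsSmooth.contDiffAt {k : ℕ} {η : DiffForm M k} (h : η.IsSmooth)
    {x₀ : M} {y : E7} (hy : y ∈ (extChartAt (𝓡 7) x₀).target) :
    ContDiffAt ℝ ∞ (η.inChart x₀) y :=
  (h x₀).contDiffAt ((isOpen_extChartAt_target x₀).mem_nhds hy)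

/-- A parallel `φ` is closed. -/
theorem GTwoStructure.IsTorsionFree.extDeriv_eq_zero {G : GTwoStructure M} (hG : G.IsTorsionFree)
    {x₀ : M} {y : E7} (hy : y ∈ (extChartAt (𝓡 7) x₀).target) :
    extDeriv (G.φ.inChart x₀) y = 0 := by
  refine form_ext fun f => ?_
  rw [extDeriv_apply ((G.smooth.contDiffAt hy).differentiableAt (by simp)),
    ContinuousAlternatingMap.coe_zero, Pi.zero_apply]
  have h : ∀ i : Fin 4, fderiv ℝ (fun z => G.φ.inChart x₀ z (i.removeNth (stdVec ∘ f))) y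
      ((stdVec ∘ f) i) = ∑ m : Fin 7, ∑ s : Fin 3, G.christoffel x₀ y m (f i) (i.removeNth f s) *
        G.φ.inChart x₀ y (fun a => stdVec (Function.update (i.removeNth f) s m a)) := by
    intro i
    rw [Finset.sum_comm]
    exact sub_eq_zero.1 (hG x₀ y hy (f i) (i.removeNth f))
  -- Parallelism replaces each partial derivative of `φ` by its Christoffel terms.
  simp only [h, zsmul_eq_mul, Int.cast_pow, Int.cast_neg, Int.cast_one, Finset.mul_sum]
  rw [Finset.sum_comm]
  simp only [← Finset.mul_sum]
  exact Finset.sum_eq_zero fun m _ => sum_symm_mul_update_eq_zero stdVec _ _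
    (G.christoffel_comm x₀ y m) f m

end

/-! ### Differential forms in charts -/

section
variable {M : Type*} [TopologicalSpace M] [ChartedSpace E7 M]

theorem DiffForm.inChart_wedge {k l : ℕ} (α : DiffForm M k) (β : DiffForm M l) (x₀ : M) (y : E7) :
    (α.wedge β).inChart x₀ y = GTwo.wedge (α.inChart x₀ y) (β.inChart x₀ y) :=
  wedge_compContinuousLinearMap _ _ _

theorem DiffForm.inChart_zero {k : ℕ} (x₀ : M) (y : E7) :
    (0 : DiffForm M k).inChart x₀ y = 0 := by
  ext v
  rfl

/-- All tangent spaces are the type `E7`, so the values of a form at two equal points can be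
compared on the same vectors. -/
theorem DiffForm.apply_congr {k : ℕ} (η : DiffForm M k) {p q : M} (h : p = q)
    (v : Fin k → E7) :
    η p (fun i => (show TangentSpace (𝓡 7) p from v i)) =
      η q (fun i => (show TangentSpace (𝓡 7) q from v i)) := by
  subst h
  rfl

variable [IsManifold (𝓡 7) ∞ M]

theorem isManifold_one : IsManifold (𝓡 7) 1 M := IsManifold.of_le (n := ∞) (by norm_cast)

theorem mdifferentiableAt_extChartAt_symm {x₀ : M} {y : E7}
    (hy : y ∈ (extChartAt (𝓡 7) x₀).target) :
    MDifferentiableAt 𝓘(ℝ, E7) (𝓡 7) (extChartAt (𝓡 7) x₀).symm y := by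
  have : IsManifold (𝓡 7) 1 M := isManifold_one
  have h := mdifferentiableWithinAt_extChartAt_symm hy
  rwa [ModelWithCorners.range_eq_univ, mdifferentiableWithinAt_univ] at h

theorem mdifferentiableAt_extChartAt_of_mem {x₀ x : M}
    (hx : x ∈ (extChartAt (𝓡 7) x₀).source) :
    MDifferentiableAt (𝓡 7) 𝓘(ℝ, E7) (extChartAt (𝓡 7) x₀) x := by
  have : IsManifold (𝓡 7) 1 M := isManifold_one
  rw [extChartAt_source] at hx
  exact mdifferentiableAt_extChartAt hx

/-- At its centre, the derivative of the inverse of the preferred chart is the identity of `E7`. -/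
theorem mfderiv_extChartAt_symm_self (x : M) (u : E7) :
    mfderiv 𝓘(ℝ, E7) (𝓡 7) (extChartAt (𝓡 7) x).symm (extChartAt (𝓡 7) x x) u = u := by
  have : IsManifold (𝓡 7) 1 M := isManifold_one
  have h := mfderivWithin_range_extChartAt_symm (I := 𝓡 7) (x := x)
  rw [ModelWithCorners.range_eq_univ, mfderivWithin_univ] at h
  exact congrArg (fun L : E7 →L[ℝ] E7 => L u) h

theorem DiffForm.inChart_self {k : ℕ} (η : DiffForm M k) (x : M) :
    η.inChart x (extChartAt (𝓡 7) x x) = η x := by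
  ext v
  refine Eq.trans (congrArg (η ((extChartAt (𝓡 7) x).symm (extChartAt (𝓡 7) x x))) ?_)
    (η.apply_congr ((extChartAt (𝓡 7) x).left_inv (mem_extChartAt_source x)) v)
  exact funext fun i => mfderiv_extChartAt_symm_self x (v i)

theorem DiffForm.d_eq_extDeriv {k : ℕ} (η : DiffForm M k) (x : M) :
    η.d x = extDeriv (η.inChart x) (extChartAt (𝓡 7) x x) := by
  have : IsManifold (𝓡 7) 1 M := isManifold_one
  ext v
  refine congrArg (extDeriv (η.inChart x) (extChartAt (𝓡 7) x x)) (funext fun i => ?_)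
  exact congrArg (fun L : E7 →L[ℝ] E7 => L (v i)) (mfderiv_extChartAt_self (I := 𝓡 7) (x := x))

/-- The exterior derivative, defined at each point by the chart centred there, is computed by every
chart: the coordinate change pulls one local expression back to the other, and `extDeriv` commutes
with pullback. -/
theorem DiffForm.inChart_d {k : ℕ} {η : DiffForm M k} (hη : η.IsSmooth) {x₀ : M} {y : E7}
    (hy : y ∈ (extChartAt (𝓡 7) x₀).target) :
    η.d.inChart x₀ y = extDeriv (η.inChart x₀) y := by
  set x := (extChartAt (𝓡 7) x₀).symm y with hx
  -- the change of coordinates from the chart around `x₀` to the one around `x`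
  let τ : E7 → E7 := extChartAt (𝓡 7) x ∘ (extChartAt (𝓡 7) x₀).symm
  have hxs : (extChartAt (𝓡 7) x₀).symm y ∈ (extChartAt (𝓡 7) x).source :=
    mem_extChartAt_source x
  have hτ : ContDiffAt ℝ ∞ τ y := by
    rw [← contMDiffAt_iff_contDiffAt]
    refine ContMDiffAt.comp (I' := 𝓡 7) y (contMDiffAt_extChartAt' ?_)
      ((contMDiffOn_extChartAt_symm x₀).contMDiffAt ((isOpen_extChartAt_target x₀).mem_nhds hy))
    rwa [extChartAt_source] at hxs
  have hnhds : ∀ᶠ z in 𝓝 y, z ∈ (extChartAt (𝓡 7) x₀).target ∧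
      (extChartAt (𝓡 7) x₀).symm z ∈ (extChartAt (𝓡 7) x).source := by
    refine Filter.Eventually.and ((isOpen_extChartAt_target x₀).mem_nhds hy) ?_
    exact (continuousAt_extChartAt_symm'' hy).eventually
      ((isOpen_extChartAt_source x).mem_nhds (mem_extChartAt_source x))
  have hcomp : ∀ z ∈ (extChartAt (𝓡 7) x₀).target,
      (extChartAt (𝓡 7) x₀).symm z ∈ (extChartAt (𝓡 7) x).source →
      MDifferentiableAt 𝓘(ℝ, E7) 𝓘(ℝ, E7) τ z ∧
      mfderiv 𝓘(ℝ, E7) 𝓘(ℝ, E7) τ z = (mfderiv (𝓡 7) 𝓘(ℝ, E7) (extChartAt (𝓡 7) x)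
        ((extChartAt (𝓡 7) x₀).symm z)).comp
        (mfderiv 𝓘(ℝ, E7) (𝓡 7) (extChartAt (𝓡 7) x₀).symm z) := by
    intro z hz hz'
    have h1 := mdifferentiableAt_extChartAt_of_mem hz'
    have h2 := mdifferentiableAt_extChartAt_symm hz
    exact ⟨h1.comp z h2, mfderiv_comp z h1 h2⟩
  have hpull : η.inChart x₀ =ᶠ[𝓝 y] fun z =>
      (η.inChart x (τ z)).compContinuousLinearMap (fderiv ℝ τ z) := by
    filter_upwards [hnhds, hnhds.eventually_nhds] with z hz hz'
    ext v
    have hτz : (extChartAt (𝓡 7) x).symm (τ z) = (extChartAt (𝓡 7) x₀).symm z :=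
      (extChartAt (𝓡 7) x).left_inv hz.2
    have hd : mfderiv 𝓘(ℝ, E7) (𝓡 7) (extChartAt (𝓡 7) x₀).symm z =
        (mfderiv 𝓘(ℝ, E7) (𝓡 7) (extChartAt (𝓡 7) x).symm (τ z)).comp
          (mfderiv 𝓘(ℝ, E7) 𝓘(ℝ, E7) τ z) := by
      have he : (extChartAt (𝓡 7) x₀).symm =ᶠ[𝓝 z] (extChartAt (𝓡 7) x).symm ∘ τ := by
        filter_upwards [hz'] with w hw
        exact ((extChartAt (𝓡 7) x).left_inv hw.2).symm
      rw [he.mfderiv_eq]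
      exact mfderiv_comp z (mdifferentiableAt_extChartAt_symm
        ((extChartAt (𝓡 7) x).map_source hz.2)) (hcomp z hz.1 hz.2).1
    rw [mfderiv_eq_fderiv] at hd
    refine Eq.trans (congrArg (η ((extChartAt (𝓡 7) x₀).symm z)) (funext fun i => ?_))
      (η.apply_congr hτz.symm fun i =>
        mfderiv 𝓘(ℝ, E7) (𝓡 7) (extChartAt (𝓡 7) x).symm (τ z) (fderiv ℝ τ z (v i)))
    exact congrArg (fun L : E7 →L[ℝ] E7 => L (v i)) hd
  rw [hpull.extDeriv_eq, extDeriv_pullback (r := ∞) _ hτ (by simpa using ENat.LEInfty.out)]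
  · ext v
    have hd := (hcomp y hy hxs).2
    rw [mfderiv_eq_fderiv] at hd
    refine congrArg (extDeriv (η.inChart x) (τ y)) (funext fun i => ?_)
    exact congrArg (fun L : E7 →L[ℝ] E7 => L (v i)) hd.symm
  · exact (hη.contDiffAt (mem_extChartAt_target x)).differentiableAt (by simp)

end

/-! ### Special higher-order instantons -/

section
variable {M : Type*} [TopologicalSpace M] [ChartedSpace E7 M]

/-- The form `η_x` transported to `ℝ⁷` by the chosen isomorphism that carries `φ_x` to `φ₀`. -/
def GTwoStructure.inFrame (G : GTwoStructure M) {k : ℕ} (η : DiffForm M k) (x : M) :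
    E7 [⋀^Fin k]→L[ℝ] ℝ :=
  (η x).compContinuousLinearMap ((G.frame x).symm : E7 →L[ℝ] TangentSpace (𝓡 7) x)

namespace GTwoStructure

variable (G : GTwoStructure M)

theorem inFrame_frame {k : ℕ} (η : DiffForm M k) (x : M) (v : Fin k → TangentSpace (𝓡 7) x) :
    G.inFrame η x (fun i => G.frame x (v i)) = η x v := by
  simp only [inFrame, ContinuousAlternatingMap.compContinuousLinearMap_apply]
  refine congrArg (η x) (funext fun i => ?_)
  exact (G.frame x).symm_apply_apply (v i)

theorem inFrame_eq_zero {k : ℕ} {η : DiffForm M k} {x : M} :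
    G.inFrame η x = 0 ↔ η x = 0 := by
  constructor
  · intro h
    ext v
    rw [← G.inFrame_frame, h]
    rfl
  · intro h
    rw [inFrame, h]
    rfl

theorem inFrame_wedge {k l : ℕ} (α : DiffForm M k) (β : DiffForm M l) (x : M) :
    G.inFrame (α.wedge β) x = wedge (G.inFrame α x) (G.inFrame β x) :=
  wedge_compContinuousLinearMap _ _ _

theorem inFrame_star {k l : ℕ} (h : k + l = 7) (β : DiffForm M k) (x : M) :
    G.inFrame (G.star h β) x = star0 h (G.inFrame β x) := by
  ext v
  refine congrArg (star0 h (G.inFrame β x)) (funext fun i => ?_)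
  exact (G.frame x).apply_symm_apply (v i)

theorem inFrame_phi (x : M) : G.inFrame G.φ x = phi0 := by
  rw [inFrame, G.phi_eq]
  ext v
  refine congrArg phi0 (funext fun i => ?_)
  exact (G.frame x).apply_symm_apply (v i)

end GTwoStructure

variable [IsManifold (𝓡 7) ∞ M]

theorem DiffForm.d_wedge_d_eq_zero {B : DiffForm M 1} (hB : B.IsSmooth)
    (h : B.wedge B.d = 0) : B.d.wedge B.d = 0 := by
  funext x
  have hx := mem_extChartAt_target (I := 𝓡 7) x
  have key := wedge_extDeriv_sq_eq_zero (hB.contDiffAt hx) (by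
      filter_upwards [(isOpen_extChartAt_target x).mem_nhds hx] with y hy
      rw [← DiffForm.inChart_d hB hy, ← DiffForm.inChart_wedge, h, DiffForm.inChart_zero])
  rw [← DiffForm.inChart_d hB hx, ← DiffForm.inChart_wedge, DiffForm.inChart_self] at key
  exact key

namespace GTwoStructure
variable {G : GTwoStructure M} {B : DiffForm M 1}

/-- Since `dφ = 0`, differentiating `φ ∧ B ∧ dB = 0` gives `φ ∧ dB ∧ dB = 0`. -/
theorem phi_wedge_d_wedge_d_eq_zero (hG : G.IsTorsionFree) (hB : B.IsSmooth)
    (h : G.φ.wedge (B.wedge B.d) = 0) : G.φ.wedge (B.d.wedge B.d) = 0 := by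
  funext x
  have hx := mem_extChartAt_target (I := 𝓡 7) x
  have key := wedge_wedge_extDeriv_sq_eq_zero
    ((G.smooth.contDiffAt hx).differentiableAt (by simp)) (hG.extDeriv_eq_zero hx)
    (hB.contDiffAt hx) (by
      filter_upwards [(isOpen_extChartAt_target x).mem_nhds hx] with y hy
      rw [← DiffForm.inChart_d hB hy, ← DiffForm.inChart_wedge, ← DiffForm.inChart_wedge, h,
        DiffForm.inChart_zero])
  rw [← DiffForm.inChart_d hB hx, ← DiffForm.inChart_wedge, ← DiffForm.inChart_wedge,
    DiffForm.inChart_self] at key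
  exact key

/-- A special higher-order instanton satisfies `B ∧ dB = 0`: not only the `φ`- and `ψ`-components of
`B ∧ dB` vanish, but all of it. -/
theorem IsSpecialHigherOrderInstanton.wedge_d_eq_zero (hG : G.IsTorsionFree) (hB : B.IsSmooth)
    (h : G.IsSpecialHigherOrderInstanton B) : B.wedge B.d = 0 := by
  funext x
  refine G.inFrame_eq_zero.1 ?_
  have h1 := G.inFrame_eq_zero.2 (congrFun h.1 x)
  have h2 := G.inFrame_eq_zero.2 (congrFun h.2 x)
  have h3 := G.inFrame_eq_zero.2 (congrFun (phi_wedge_d_wedge_d_eq_zero hG hB h.1) x)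
  rw [inFrame_wedge, inFrame_wedge, inFrame_phi] at h1 h3
  rw [inFrame_wedge, inFrame_wedge, psi, inFrame_star, inFrame_phi] at h2
  rw [inFrame_wedge]
  exact wedge_eq_zero_of_special h1 h2 h3

theorem d_eq_zero_of_wedge_star (hB : B.IsSmooth) (h1 : B.wedge B.d = 0)
    (h2 : B.wedge (G.star (k := 2) (l := 5) rfl B.d) = 0) : B.d = 0 := by
  have key : ∀ (x : M) (u : TangentSpace (𝓡 7) x), B x (fun _ => u) • B.d x = 0 := by
    intro x u
    have h1' := G.inFrame_eq_zero.2 (congrFun h1 x)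
    have h2' := G.inFrame_eq_zero.2 (congrFun h2 x)
    rw [inFrame_wedge] at h1' h2'
    rw [inFrame_star] at h2'
    have h3 := tensor_eq_zero h1' h2' (G.frame x u)
    rw [G.inFrame_frame B x (fun _ => u)] at h3
    ext v
    have h4 := congrArg (fun γ : E7 [⋀^Fin 2]→L[ℝ] ℝ => γ (fun i => G.frame x (v i))) h3
    refine Eq.trans ?_ h4
    exact congrArg (B x (fun _ => u) * ·) (G.inFrame_frame B.d x v).symm
  funext x
  have hx := mem_extChartAt_target (I := 𝓡 7) x
  rw [DiffForm.d_eq_extDeriv]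
  refine extDeriv_eq_zero_of_smul_eq_zero (hB.contDiffAt hx) ?_
  filter_upwards [(isOpen_extChartAt_target x).mem_nhds hx] with y hy u
  rw [← DiffForm.inChart_d hB hy]
  ext v
  exact congrArg (fun γ => γ fun i => mfderiv 𝓘(ℝ, E7) (𝓡 7) (extChartAt (𝓡 7) x).symm y (v i))
    (key ((extChartAt (𝓡 7) x).symm y)
      (mfderiv 𝓘(ℝ, E7) (𝓡 7) (extChartAt (𝓡 7) x).symm y u))

end GTwoStructure
end

end GTwo

end

theorem theorem3p8 {M : Type*} [TopologicalSpace M] [ChartedSpace GTwo.E7 M]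
    [IsManifold (𝓡 7) ∞ M] (G : GTwo.GTwoStructure M) (hG : G.IsTorsionFree)
    (B : GTwo.DiffForm M 1) (hB : B.IsSmooth) (hspecial : G.IsSpecialHigherOrderInstanton B) :
    G.IsAntiSelfDualHigherOrderInstanton B ∧
      (B.IsClosed ↔ B.wedge (G.star (k := 2) (l := 5) rfl B.d) = 0) := by
  have h1 := hspecial.wedge_d_eq_zero hG hB
  have h2 := GTwo.DiffForm.d_wedge_d_eq_zero hB h1
  refine ⟨?_, fun h => ?_, fun h => GTwo.GTwoStructure.d_eq_zero_of_wedge_star hB h1 h⟩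
  · refine ⟨GTwo.GTwoStructure.phi_wedge_d_wedge_d_eq_zero hG hB hspecial.1, ?_⟩
    rw [h2]
    funext x
    refine G.inFrame_eq_zero.1 ?_
    rw [G.inFrame_wedge, G.inFrame_star,
      G.inFrame_eq_zero.2 (show (0 : GTwo.DiffForm M 4) x = 0 from rfl), GTwo.star0_zero,
      GTwo.wedge_zero_right]
  · funext x
    refine G.inFrame_eq_zero.1 ?_
    rw [G.inFrame_wedge, G.inFrame_star, G.inFrame_eq_zero.2 (congrFun h x), GTwo.star0_zero,
      GTwo.wedge_zero_right]
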